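/- Let $\pi: I \to J$ be a surjection of finite sets, with fibres $I^j=\pi^{-1}(j)$, and let $\mathcal G$ be the complete multipartite graph on $I$ with parts $I^j$ (two nodes are adjacent iff they lie in different parts), regarded as a quiver with one arrow $\alpha_{ij}: j\to i$ for every ordered pair of adjacent nodes. Let $a: J\to \mathbb C\cup\{\infty\}$ be injective, and write $a_i$ for $a_{\pi(i)}$ when $i \in I$. For $i \ne j$ put $\delta_{ij}=a_i-a_j$ if $a_i,a_j$ are finite, $\delta_{ij}=1$ if $a_j=\infty$, and $\delta_{ij}=-1$ if $a_i=\infty$; put $\phi_{ij}=\delta_{ij}^{-1}$. Let $(V_i)_{i\in I}$ be finite-dimensional complex vector spaces, $W^j=\bigoplus_{i\in I^j}V_i$, and $\mathbb M=\bigoplus_{i\neq j\in J}\mathrm{Hom}(W^i,W^j)$, with components $B^{ji}:W^i\to W^j$. Put $X^{ij}=\phi_{ij}B^{ij}$ and $$\omega_a=\tfrac12\sum_{i\ne j\in J}\mathrm{Tr}\big(dX^{ij}\wedge dB^{ji}\big),$$ a symplectic form on $\mathbb M$. Let $A$ be the Weyl algebra of $(\mathbb M,\omega_a)$, i.e. the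 tensor algebra of $\mathbb M$ modulo the two-sided ideal generated by the elements $x\otimes y-y\otimes x-\omega_a(x,y)$; a linear function $f=\omega_a(x,\cdot)$ on $\mathbb M$ is quantised to the class $\widehat f\in A$ of $x$. For an arrow $\alpha=\alpha_{ij}$ of $\mathcal G$ let $\widehat X^{\alpha}$ be the matrix over $A$ whose entries are the quantisations of the entries, in fixed bases of the $V_i$, of the component $V_j\to V_i$ of $X^{\pi(i)\pi(j)}$. The trace of an anchored cycle $\alpha_n\cdots\underline{\alpha_1}$ (an oriented cycle with chosen first arrow $\alpha_1$) is $\mathrm{Tr}(\widehat X^{\alpha_n}\cdots\widehat X^{\alpha_1})\in A$, and $\mathrm{Tr}$ is extended linearly. Let $\mathbf B=\prod_{j\in J}\big(\mathbb C^{I^j}\setminus\{\mathrm{diagonals}\}\big)\subseteq\mathbb C^I$, with coordinates $t_i$. For $i\in I$ consider the following time-dependent combinations of oriented cycles, where $I^i$ denotes the part containing the node $i$: $$W_i(2)=\sum_{j\in I\setminus I^i}w_{ij}\,\alpha_{ij}\alpha_{ji},\qquad W_i(3)=\sum_{\substack{j,l\in I\setminus I^i\\ I^j\neq I^l}}\delta_{jl}\,\alpha_{il}\alpha_{lj}\alpha_{ji},$$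 $$W_i(4)=\sum_{\substack{m\in I^i\setminus\{i\}\\ j,l\in I\setminus I^i}}\frac{\delta_{ij}\,\delta_{il}}{t_i-t_m}\,\alpha_{ij}\alpha_{jm}\alpha_{ml}\alpha_{li},$$ where $w_{ij}=t_i-t_j$ if $a_i,a_j$ are finite, $w_{ij}=-t_j$ if $a_j=\infty$, and $w_{ij}=-a_jt_i-t_j$ if $a_i=\infty$. (If all $a_j$ are finite, all the weights $\delta_{ij}$ are the differences $a_i-a_j$.) The quantisation $\widehat W_i$ of $W_i=W_i(4)+W_i(3)+W_i(2)$ is obtained by anchoring its cycles: a $2$-cycle is replaced by the average of its two anchorings; a degenerate $4$-cycle ($j=l$) is anchored at an arrow coming out of its centre $j$, i.e. is replaced by $\alpha_{jm}\alpha_{mj}\alpha_{ji}\underline{\alpha_{ij}}$; the $3$-cycles and the nondegenerate $4$-cycles are anchored at an arrow coming out of the node $i$. Set $\widehat H_i=\mathrm{Tr}(\widehat W_i):\mathbf B\to A$. Then the simply-laced quantum connection $\widehat\nabla=d_{\mathbf B}-\sum_{i\in I}\widehat H_i\,dt_i$ on the trivial bundle $A\times\mathbf B\to\mathbf B$ (where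 $A$ acts on itself by left multiplication) is strongly flat: for all $i,j\in I$, everywhere on $\mathbf B$, $$[\widehat H_i,\widehat H_j]=0\qquad\text{and}\qquad \frac{\partial\widehat H_i}{\partial t_j}=\frac{\partial\widehat H_j}{\partial t_i}.$$ -/

import Mathlib

open scoped OnePoint

noncomputable section

namespace SLQC

/-! ### Weyl algebras -/

/-- The relations `x ⊗ y - y ⊗ x = ω(x, y)`, for `x, y` in the vector space `M`. -/
inductive WeylRel {M : Type*} [AddCommGroup M] [Module ℂ M] (ω : LinearMap.BilinForm ℂ M) :
    TensorAlgebra ℂ M → TensorAlgebra ℂ M → Prop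
  | of (x y : M) : WeylRel ω
      (TensorAlgebra.ι ℂ x * TensorAlgebra.ι ℂ y - TensorAlgebra.ι ℂ y * TensorAlgebra.ι ℂ x)
      (algebraMap ℂ (TensorAlgebra ℂ M) (ω x y))

/-- The Weyl algebra of `(M, ω)`: the tensor algebra of `M` modulo the two-sided ideal generated by
the elements `x ⊗ y - y ⊗ x - ω(x, y)`. -/
abbrev WeylAlgebra {M : Type*} [AddCommGroup M] [Module ℂ M] (ω : LinearMap.BilinForm ℂ M) :=
  RingQuot (WeylRel ω)

/-- The canonical linear map from `M` to the Weyl algebra of `(M, ω)`. -/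
def WeylAlgebra.ι {M : Type*} [AddCommGroup M] [Module ℂ M] (ω : LinearMap.BilinForm ℂ M) :
    M →ₗ[ℂ] WeylAlgebra ω :=
  (RingQuot.mkAlgHom ℂ (WeylRel ω)).toLinearMap ∘ₗ TensorAlgebra.ι ℂ

/-- The linear quantisation `f ↦ f̂` of the linear functions on a symplectic vector space `(M, ω)`:
it sends `f = ω(x, ·)` to the class of `x` in the Weyl algebra. -/
def linearQuantisation {M : Type*} [AddCommGroup M] [Module ℂ M] [FiniteDimensional ℂ M]
    (ω : LinearMap.BilinForm ℂ M) (hω : ω.Nondegenerate) :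
    Module.Dual ℂ M →ₗ[ℂ] WeylAlgebra ω :=
  WeylAlgebra.ι ω ∘ₗ (LinearMap.BilinForm.toDual ω hω).symm.toLinearMap

/-! ### Readings and weights -/

/-- The difference `x - y` of two values of a reading, with the convention that
`x - ∞ = 1` and `∞ - y = -1`. -/
def gap : OnePoint ℂ → OnePoint ℂ → ℂ
  | OnePoint.some x, OnePoint.some y => x - y
  | OnePoint.some _, ∞ => 1
  | ∞, OnePoint.some _ => -1
  | ∞, ∞ => 0

/-- The alternating weights `φ_{ij}` of a reading `a`, equal to `(a_i - a_j)⁻¹` when `a_i` and `a_j`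
are both finite, and to `1` (resp. `-1`) when `a_j = ∞` (resp. `a_i = ∞`). -/
def phi {J : Type*} (a : J → OnePoint ℂ) (i j : J) : ℂ := (gap (a i) (a j))⁻¹

theorem gap_ne_zero : ∀ {x y : OnePoint ℂ}, x ≠ y → gap x y ≠ 0
  | OnePoint.some x, OnePoint.some y, h => by
      simp only [gap]
      exact sub_ne_zero.2 fun e => h (congrArg _ e)
  | OnePoint.some _, ∞, _ => by simp [gap]
  | ∞, OnePoint.some _, _ => by simp [gap]
  | ∞, ∞, h => absurd rfl h

theorem gap_swap : ∀ x y : OnePoint ℂ, gap x y = -gap y x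
  | OnePoint.some x, OnePoint.some y => by simp [gap]
  | OnePoint.some _, ∞ => by simp [gap]
  | ∞, OnePoint.some _ => by simp [gap]
  | ∞, ∞ => by simp [gap]

/-! ### The symplectic vector space `(𝕄, ω_a)` -/

/-- `W^j = ⨁_{i ∈ I^j} V_i`, where `I^j = π⁻¹(j)`. -/
abbrev PartSpace {J I : Type*} (π : I → J) (V : I → Type*) (j : J) :=
  (i : {i : I // π i = j}) → V i

/-- `𝕄 = ⨁_{i ≠ j ∈ J} Hom(W^i, W^j)`. The component of `u` at `(i, j)` is the linear map
`B^{ji} : W^i → W^j`. -/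
abbrev RepSpace {J I : Type*} (π : I → J) (V : I → Type*) [∀ i, AddCommGroup (V i)]
    [∀ i, Module ℂ (V i)] :=
  (p : {p : J × J // p.1 ≠ p.2}) → (PartSpace π V p.1.1 →ₗ[ℂ] PartSpace π V p.1.2)

/-- The opposite of an ordered pair of distinct elements of `J`. -/
abbrev opp {J : Type*} (p : {p : J × J // p.1 ≠ p.2}) : {p : J × J // p.1 ≠ p.2} :=
  ⟨(p.1.2, p.1.1), p.2.symm⟩

section Symplectic

variable {J I : Type*} [Fintype J] (π : I → J) (a : J → OnePoint ℂ)
  (V : I → Type*) [∀ i, AddCommGroup (V i)] [∀ i, Module ℂ (V i)]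

/-- The linear map `B^{ji} : W^i → W^j` attached to a point of `𝕄`, for `p = (i, j)`. -/
def blockB (p : {p : J × J // p.1 ≠ p.2}) :
    RepSpace π V →ₗ[ℂ] (PartSpace π V p.1.1 →ₗ[ℂ] PartSpace π V p.1.2) :=
  LinearMap.proj p

/-- The linear map `X^{ij} = φ_{ij} B^{ij} : W^j → W^i` attached to a point of `𝕄`,
for `p = (i, j)`. -/
def blockX (p : {p : J × J // p.1 ≠ p.2}) :
    RepSpace π V →ₗ[ℂ] (PartSpace π V p.1.2 →ₗ[ℂ] PartSpace π V p.1.1) :=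
  phi a p.1.1 p.1.2 • blockB π V (opp p)

open Classical in
/-- The symplectic form `ω_a = ½ ∑_{i ≠ j} Tr(dX^{ij} ∧ dB^{ji})`. -/
def omega : LinearMap.BilinForm ℂ (RepSpace π V) :=
  LinearMap.mk₂ ℂ
    (fun u v => (1 / 2 : ℂ) * ∑ p : {p : J × J // p.1 ≠ p.2},
      (LinearMap.trace ℂ (PartSpace π V p.1.1) (blockX π a V p u ∘ₗ blockB π V p v) -
        LinearMap.trace ℂ (PartSpace π V p.1.1) (blockX π a V p v ∘ₗ blockB π V p u)))
    (fun u u' v => by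
      rw [← mul_add, ← Finset.sum_add_distrib]
      congr 1
      refine Finset.sum_congr rfl fun p _ => ?_
      simp only [map_add, LinearMap.add_comp, LinearMap.comp_add]
      ring)
    (fun c u v => by
      rw [smul_eq_mul, mul_left_comm c, Finset.mul_sum _ _ c]
      congr 1
      refine Finset.sum_congr rfl fun p _ => ?_
      simp only [map_smul, LinearMap.smul_comp, LinearMap.comp_smul, smul_eq_mul]
      ring)
    (fun u v v' => by
      rw [← mul_add, ← Finset.sum_add_distrib]
      congr 1
      refine Finset.sum_congr rfl fun p _ => ?_
      simp only [map_add, LinearMap.add_comp, LinearMap.comp_add]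
      ring)
    (fun c u v => by
      rw [smul_eq_mul, mul_left_comm c, Finset.mul_sum _ _ c]
      congr 1
      refine Finset.sum_congr rfl fun p _ => ?_
      simp only [map_smul, LinearMap.smul_comp, LinearMap.comp_smul, smul_eq_mul]
      ring)

open Classical in
theorem omega_apply (u v : RepSpace π V) :
    omega π a V u v = (1 / 2 : ℂ) * ∑ p : {p : J × J // p.1 ≠ p.2},
      (LinearMap.trace ℂ (PartSpace π V p.1.1) (blockX π a V p u ∘ₗ blockB π V p v) -
        LinearMap.trace ℂ (PartSpace π V p.1.1) (blockX π a V p v ∘ₗ blockB π V p u)) := rfl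

theorem omega_swap (u v : RepSpace π V) : omega π a V u v = -omega π a V v u := by
  rw [omega_apply, omega_apply, ← mul_neg, ← Finset.sum_neg_distrib]
  simp only [neg_sub]

variable [Fintype I] [∀ i, FiniteDimensional ℂ (V i)]

open Classical in
theorem omega_eq_sum (u v : RepSpace π V) :
    omega π a V u v = ∑ p : {p : J × J // p.1 ≠ p.2}, phi a p.1.1 p.1.2 *
      LinearMap.trace ℂ (PartSpace π V p.1.1) (u (opp p) ∘ₗ v p) := by
  have key : ∑ p : {p : J × J // p.1 ≠ p.2},
      LinearMap.trace ℂ (PartSpace π V p.1.1) (blockX π a V p v ∘ₗ blockB π V p u) =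
      -∑ p : {p : J × J // p.1 ≠ p.2},
      LinearMap.trace ℂ (PartSpace π V p.1.1) (blockX π a V p u ∘ₗ blockB π V p v) := by
    rw [← Finset.sum_neg_distrib]
    refine Fintype.sum_equiv ⟨opp, opp, fun _ => rfl, fun _ => rfl⟩ _ _ fun p => ?_
    simp only [blockX, blockB, phi, Equiv.coe_fn_mk, LinearMap.smul_apply, LinearMap.proj_apply,
      LinearMap.smul_comp, map_smul, smul_eq_mul]
    rw [gap_swap (a p.1.2) (a p.1.1), inv_neg, neg_mul, neg_neg,
      LinearMap.trace_comp_comm']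
  rw [omega_apply, Finset.sum_sub_distrib, key]
  rw [sub_neg_eq_add, ← two_mul, ← mul_assoc, one_div_mul_cancel two_ne_zero, one_mul]
  refine Finset.sum_congr rfl fun p _ => ?_
  simp [blockX, blockB, LinearMap.smul_comp]

variable {a}

theorem omega_nondegenerate (ha : Function.Injective a) : (omega π a V).Nondegenerate := by
  classical
  have hl : ∀ u, (∀ v, omega π a V u v = 0) → u = 0 := by
    intro u hu
    funext q
    refine LinearMap.ext fun w => ?_
    refine (Module.forall_dual_apply_eq_zero_iff ℂ (u q w)).1 fun f => ?_
    have h := hu (Pi.single (opp q) (f.smulRight w))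
    rw [omega_eq_sum, Finset.sum_eq_single (opp q)] at h
    · rw [Pi.single_eq_same] at h
      have hne : phi a (opp q).1.1 (opp q).1.2 ≠ 0 :=
        inv_ne_zero (gap_ne_zero fun e => q.2 (ha e).symm)
      have h2 := (mul_eq_zero.1 h).resolve_left hne
      have h3 : u (opp (opp q)) ∘ₗ f.smulRight w = f.smulRight (u q w) := by
        refine LinearMap.ext fun x => ?_
        simp only [LinearMap.comp_apply, LinearMap.smulRight_apply, map_smul]
      rw [h3, LinearMap.trace_smulRight] at h2
      exact h2
    · intro p _ hp
      rw [Pi.single_eq_of_ne hp, LinearMap.comp_zero, map_zero, mul_zero]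
    · exact fun hn => absurd (Finset.mem_univ _) hn
  exact ⟨hl, fun v hv => hl v fun u => by rw [omega_swap, hv, neg_zero]⟩

end Symplectic

/-! ### The complete multipartite graph, anchored cycles and quantum potentials -/

/-- The complete multipartite graph `𝒢` on the nodes `I`, with parts the fibres of `π`: two nodes
are adjacent if and only if they lie in different parts. -/
def multipartiteGraph {J I : Type*} (π : I → J) : SimpleGraph I where
  Adj i j := π i ≠ π j
  symm := ⟨fun _ _ h => h.symm⟩
  loopless := ⟨fun _ h => h rfl⟩

/-- An anchored cycle `α_n ⋯ α_1` in (the double quiver of) `𝒢` is a closed walk; its anchor is its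
first arrow `α_1`, and its starting node is the tail of `α_1`. -/
abbrev AnchoredCycle {J I : Type*} (π : I → J) := Σ i : I, (multipartiteGraph π).Walk i i

/-- Quantum potentials, represented as formal complex linear combinations of anchored cycles. -/
abbrev QuantumPotential {J I : Type*} (π : I → J) := AnchoredCycle π →₀ ℂ

section Cycles

variable {J I : Type*} (π : I → J)

/-- The anchored cycle `α_{ij} α_{ji}`, anchored at `α_{ji} : i → j`. -/
def twoCycle (i j : I) (hij : π i ≠ π j) : AnchoredCycle π :=
  ⟨i, .cons (v := j) hij (.cons (v := i) hij.symm .nil)⟩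

/-- The anchored cycle `α_{il} α_{lj} α_{ji}`, anchored at `α_{ji} : i → j`. -/
def threeCycle (i j l : I) (hij : π i ≠ π j) (hjl : π j ≠ π l) (hli : π l ≠ π i) :
    AnchoredCycle π :=
  ⟨i, .cons (v := j) hij (.cons (v := l) hjl (.cons (v := i) hli .nil))⟩

/-- The anchored cycle `α_{ij} α_{jm} α_{ml} α_{li}`, anchored at `α_{li} : i → l`. -/
def fourCycle (i l m j : I) (hil : π i ≠ π l) (hlm : π l ≠ π m) (hmj : π m ≠ π j)
    (hji : π j ≠ π i) : AnchoredCycle π :=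
  ⟨i, .cons (v := l) hil (.cons (v := m) hlm (.cons (v := j) hmj (.cons (v := i) hji .nil)))⟩

/-- The quantisation of the `2`-cycle through `i` and `j`: the average of its two anchorings. -/
def quantTwoCycle (i j : I) (hij : π i ≠ π j) : QuantumPotential π :=
  (1 / 2 : ℂ) • (Finsupp.single (twoCycle π i j hij) 1 +
    Finsupp.single (twoCycle π j i hij.symm) 1)

/-- The quantisation of a `3`-cycle (all its anchorings have the same trace). -/
def quantThreeCycle (i j l : I) (hij : π i ≠ π j) (hjl : π j ≠ π l) (hli : π l ≠ π i) :
    QuantumPotential π :=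
  Finsupp.single (threeCycle π i j l hij hjl hli) 1

open Classical in
/-- The quantisation of the `4`-cycle `α_{ij} α_{jm} α_{ml} α_{li}`, where `i ≠ m` lie in the same
part. If `j = l` it is degenerate with centre `j`, and it is anchored at an arrow coming out of its
centre: it becomes `α_{jm} α_{mj} α_{ji} α_{ij}`, anchored at `α_{ij} : j → i`. If `j ≠ l` it is
nondegenerate (and all its anchorings have the same trace). -/
def quantFourCycle (i l m j : I) (hil : π i ≠ π l) (hlm : π l ≠ π m) (hmj : π m ≠ π j)
    (hji : π j ≠ π i) : QuantumPotential π :=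
  if j = l then Finsupp.single (fourCycle π j i j m hji hji.symm hmj.symm hmj) 1
  else Finsupp.single (fourCycle π i l m j hil hlm hmj hji) 1

end Cycles

/-! ### The quantum isomonodromy potentials -/

/-- The weight of the `2`-cycle `α_{ij} α_{ji}` in `W_i(2)`, where `x = a_i`, `y = a_j`, `s = t_i`
and `t = t_j`: it is `t_i - t_j` when `a_i` and `a_j` are finite. -/
def twoCycleWeight : OnePoint ℂ → OnePoint ℂ → ℂ → ℂ → ℂ
  | OnePoint.some _, OnePoint.some _, s, t => s - t
  | OnePoint.some _, ∞, _, t => -t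
  | ∞, OnePoint.some y, s, t => -(y * s) - t
  | ∞, ∞, _, _ => 0

section Potentials

variable {J I : Type*} [Fintype I] (π : I → J) (a : J → OnePoint ℂ)

open Classical in
/-- The quantisation of
`W_i(2) = ∑_{j ∈ I ∖ I^i} (t_i - t_j) α_{ij} α_{ji}`. -/
def quantW2 (i : I) (t : I → ℂ) : QuantumPotential π :=
  ∑ j : {j : I // π i ≠ π j},
    twoCycleWeight (a (π i)) (a (π j)) (t i) (t j) • quantTwoCycle π i j j.2

open Classical in
/-- The quantisation of
`W_i(3) = ∑_{j, l ∈ I ∖ I^i, I^j ≠ I^l} (a_j - a_l) α_{il} α_{lj} α_{ji}`. -/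
def quantW3 (i : I) : QuantumPotential π :=
  ∑ p : {p : I × I // π i ≠ π p.1 ∧ π p.1 ≠ π p.2 ∧ π p.2 ≠ π i},
    gap (a (π p.1.1)) (a (π p.1.2)) • quantThreeCycle π i p.1.1 p.1.2 p.2.1 p.2.2.1 p.2.2.2

open Classical in
/-- The quantisation of `W_i(4) =
∑_{m ∈ I^i ∖ {i}, j, l ∈ I ∖ I^i} (a_i - a_j) (a_i - a_l) / (t_i - t_m) α_{ij} α_{jm} α_{ml} α_{li}`.
-/
def quantW4 (i : I) (t : I → ℂ) : QuantumPotential π :=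
  ∑ m : {m : I // π m = π i ∧ m ≠ i}, ∑ j : {j : I // π j ≠ π i}, ∑ l : {l : I // π l ≠ π i},
    (gap (a (π i)) (a (π j)) * gap (a (π i)) (a (π l)) / (t i - t m)) •
      quantFourCycle π i l m j l.2.symm (fun e => l.2 (e.trans m.2.1))
        (fun e => j.2 (e.symm.trans m.2.1)) j.2

/-- The quantum isomonodromy potential `Ŵ_i = Ŵ_i(4) + Ŵ_i(3) + Ŵ_i(2)`. -/
def quantumIMDPotential (i : I) (t : I → ℂ) : QuantumPotential π :=
  quantW4 π a i t + quantW3 π a i + quantW2 π a i t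

end Potentials

/-! ### Quantum traces and the quantum Hamiltonians -/

section Traces

variable {J I : Type*} [Fintype J] [Fintype I] (π : I → J) {a : J → OnePoint ℂ}
  (ha : Function.Injective a)
  {V : I → Type*} [∀ i, AddCommGroup (V i)] [∀ i, Module ℂ (V i)]
  [∀ i, FiniteDimensional ℂ (V i)]
  {N : I → Type*} [∀ i, Fintype (N i)] (b : ∀ i, Module.Basis (N i) ℂ (V i))

open Classical in
/-- The linear function on `𝕄` given by the `(k, l)` entry, in the bases `b`, of the component
`X^α : V_u → V_v` of `X^{π(v) π(u)} : W^{π(u)} → W^{π(v)}`, where `α : u → v` is an arrow of `𝒢`. -/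
def coordX {u v : I} (h : π u ≠ π v) (k : N v) (l : N u) : Module.Dual ℂ (RepSpace π V) :=
  (b v).coord k ∘ₗ LinearMap.proj (⟨v, rfl⟩ : {i : I // π i = π v}) ∘ₗ
    LinearMap.applyₗ (Pi.single (⟨u, rfl⟩ : {i : I // π i = π u}) (b u l) : PartSpace π V (π u)) ∘ₗ
      blockX π a V ⟨(π v, π u), h.symm⟩

/-- The matrix `X̂^α` with entries in the Weyl algebra, for an arrow `α : u → v` of `𝒢`. -/
def arrowMatrix {u v : I} (h : π u ≠ π v) :
    Matrix (N v) (N u) (WeylAlgebra (omega π a V)) :=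
  Matrix.of fun k l =>
    linearQuantisation (omega π a V) (omega_nondegenerate π V ha) (coordX (a := a) π b h k l)

open Classical in
/-- The ordered product `X̂^{α_n} ⋯ X̂^{α_1}` along a walk with successive arrows `α_1, …, α_n`. -/
def walkMatrix : {u v : I} → (multipartiteGraph π).Walk u v →
    Matrix (N v) (N u) (WeylAlgebra (omega π a V))
  | _, _, .nil => 1
  | _, _, .cons h p => walkMatrix p * arrowMatrix π ha b h

/-- The quantum trace `Tr`, sending an anchored cycle `α_n ⋯ α_1` to
`Tr(X̂^{α_n} ⋯ X̂^{α_1})`, and extended linearly to quantum potentials. -/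
def quantumTrace : QuantumPotential π →ₗ[ℂ] WeylAlgebra (omega π a V) :=
  Finsupp.linearCombination ℂ fun c : AnchoredCycle π => (walkMatrix π ha b c.2).trace

/-- The quantum isomonodromy Hamiltonian `Ĥ_i = Tr(Ŵ_i)`, as a function of the times `t`. -/
def quantumHamiltonian (i : I) (t : I → ℂ) : WeylAlgebra (omega π a V) :=
  quantumTrace π ha b (quantumIMDPotential π a i t)

end Traces

/-! ### Strong flatness -/

/-- The space of times `𝐁 = ∏_{j ∈ J} (ℂ^{I^j} ∖ diagonals)`. -/
def timeSpace {J I : Type*} (π : I → J) : Set (I → ℂ) :=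
  {t | ∀ i j, i ≠ j → π i = π j → t i ≠ t j}

open Classical in
/-- `F` has partial derivative `D` with respect to `t_j` at `t`. The values of `F` lie in a complex
vector space without topology, and the derivative is taken after applying any linear functional;
for functions with values in a finite-dimensional subspace this is the usual partial derivative. -/
def HasPartialDeriv {I A : Type*} [AddCommGroup A] [Module ℂ A] (F : (I → ℂ) → A) (j : I) (D : A)
    (t : I → ℂ) : Prop :=
  ∀ f : Module.Dual ℂ A, HasDerivAt (fun s : ℂ => f (F (Function.update t j s))) (f D) (t j)

/-- Strong flatness on `B` of the connection `d_B - ∑_i H_i dt_i` on the trivial bundle `A × B`,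
where `A` is an associative algebra acting on itself by left multiplication:
`[H_i, H_j] = 0` and `∂H_i/∂t_j = ∂H_j/∂t_i` on `B`, for all `i` and `j`. -/
def IsStronglyFlat {I A : Type*} [Ring A] [Algebra ℂ A] (B : Set (I → ℂ))
    (H : I → (I → ℂ) → A) : Prop :=
  ∀ i j : I, ∀ t ∈ B, ⁅H i t, H j t⁆ = 0 ∧
    ∃ D : A, HasPartialDeriv (H i) j D t ∧ HasPartialDeriv (H j) i D t

end SLQC

end

open scoped OnePoint

noncomputable section

set_option linter.unusedSimpArgs false
set_option linter.unusedSectionVars false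

namespace SLQC

/-! ### Weight systems -/

/-! The entries of all the matrices X̂^α form a single matrix X indexed by the union of the bases.
Its commutation relations have constants depending only on the parts (`isWeylMatrix_entry`), so the
problem becomes one about such a matrix over any algebra. The elements R = ∑ gap X X, with both
indices in one part, are a quantum moment map for the general linear groups of the W^j. The quartic
part of Ĥ_i is ∑ E_im / (t_i - t_m) up to scalars, where E_im is a block Casimir in R. This is the
shape of a Casimir connection.

Scalars do not affect brackets, so commutativity is checked degree by degree: [4,4], [4,3], [4,2] +
[3,3], [3,2] and [2,2] vanish separately. Matrices built from X by products and weights constant on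
blocks are covariant under R. Hence the bracket of E_im with a node-weighted trace is a multiple of
a `momentBracket`, which alternates in i and m (`casimir_bracket`, `momentBracket_swap`). Applied to
R itself this yields the infinitesimal braid relations, and with the Arnold relation for 1 / (t_i -
t_m) it gives [4,4] = 0. Applied to the cubic matrix it gives the cancellation in [4,3]. In [4,2]
differences of quadratic weights cancel the poles. The remainder is opposite to [3,3], which is
computed directly and rewritten through R by `gap_eq` (same part) or the Plücker relation (different
parts). Entries of X are eigenvectors for the adjoint action of the quadratic parts, which handles
[3,2] and [2,2].

For the mixed derivatives scalars do matter. When i ≠ j, only the pair {i, j} contributes to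
∂Ĥ_i/∂t_j, so the contribution must be exactly symmetric. Averaging the two anchorings ensures this
for 2-cycles. For 4-cycles, anchoring the degenerate ones at their centre creates precisely the term
R_ff that makes E_im symmetric (`sum_quartic`, `casimir_swap`). -/

/-- An alternating function `gap` satisfying the Plücker relation, with a complementary
function `slope`. -/
structure WeightSystem (J : Type*) where
  gap : J → J → ℂ
  slope : J → J → ℂ
  gap_swap : ∀ x y, gap x y = -gap y x
  gap_ne_zero : ∀ {x y}, x ≠ y → gap x y ≠ 0
  plucker : ∀ x y z w, gap x y * gap z w + gap x w * gap y z - gap x z * gap y w = 0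
  gap_eq : ∀ {x y z}, x ≠ z → y ≠ z → gap x y = gap z y * slope z x - slope z y * gap z x

theorem WeightSystem.gap_self {J : Type*} (ω : WeightSystem J) (x : J) : ω.gap x x = 0 := by
  have := ω.gap_swap x x
  linear_combination this / 2

/-- The coefficient of `s` in the weight `twoCycleWeight x y s t`. -/
def readingSlope : OnePoint ℂ → OnePoint ℂ → ℂ
  | OnePoint.some _, OnePoint.some _ => 1
  | OnePoint.some _, ∞ => 0
  | ∞, OnePoint.some y => -y
  | ∞, ∞ => 0

/-- Only the coefficient of t_i depends on the reading; that of t_j is always -1. Both the pole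
cancellations and the symmetry of mixed derivatives rely on this. -/
theorem twoCycleWeight_eq : ∀ {x y : OnePoint ℂ}, x ≠ y → ∀ s t : ℂ,
    twoCycleWeight x y s t = readingSlope x y * s - t
  | OnePoint.some _, OnePoint.some _, _, s, t => by simp [twoCycleWeight, readingSlope]
  | OnePoint.some _, ∞, _, s, t => by simp [twoCycleWeight, readingSlope]
  | ∞, OnePoint.some _, _, s, t => by simp [twoCycleWeight, readingSlope]
  | ∞, ∞, h, _, _ => absurd rfl h

/-- Homogeneous coordinates for which `gap` is the determinant. -/
def homogeneous : OnePoint ℂ → ℂ × ℂ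
  | OnePoint.some x => (x, 1)
  | ∞ => (-1, 0)

theorem gap_eq_det : ∀ x y : OnePoint ℂ, gap x y =
    (homogeneous x).1 * (homogeneous y).2 - (homogeneous x).2 * (homogeneous y).1
  | OnePoint.some x, OnePoint.some y => by simp [gap, homogeneous]
  | OnePoint.some _, ∞ => by simp [gap, homogeneous]
  | ∞, OnePoint.some _ => by simp [gap, homogeneous]
  | ∞, ∞ => by simp [gap, homogeneous]

/-- In homogeneous coordinates `readingSlope z` is the determinant against a vector z' with det(z,
z') = -1, namely (1, 0) for finite z and (0, 1) for z = ∞. The identity is then the Plücker relation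
for z, z', x, y. The conventional value at (∞, ∞) breaks this description, whence the hypotheses. -/
theorem gap_eq_readingSlope : ∀ {x y z : OnePoint ℂ}, x ≠ z → y ≠ z →
    gap x y = gap z y * readingSlope z x - readingSlope z y * gap z x
  | OnePoint.some _, OnePoint.some _, OnePoint.some _, _, _ => by simp [gap, readingSlope]
  | OnePoint.some _, ∞, OnePoint.some _, _, _ => by simp [gap, readingSlope]
  | ∞, OnePoint.some _, OnePoint.some _, _, _ => by simp [gap, readingSlope]
  | ∞, ∞, OnePoint.some _, _, _ => by simp [gap, readingSlope]
  | OnePoint.some _, OnePoint.some _, ∞, _, _ => by simp [gap, readingSlope]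
  | ∞, _, ∞, h, _ => absurd rfl h
  | _, ∞, ∞, _, h => absurd rfl h

/-- The weight system of a reading. -/
def WeightSystem.ofReading {J : Type*} (a : J → OnePoint ℂ) (ha : Function.Injective a) :
    WeightSystem J where
  gap i j := SLQC.gap (a i) (a j)
  slope i j := readingSlope (a i) (a j)
  gap_swap _ _ := SLQC.gap_swap _ _
  gap_ne_zero h := SLQC.gap_ne_zero fun e => h (ha e)
  plucker x y z w := by simp only [gap_eq_det]; ring
  gap_eq hx hy := gap_eq_readingSlope (fun e => hx (ha e)) (fun e => hy (ha e))

/-! ### Matrices of generators of a Weyl algebra -/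

/-! ### Commutator calculus in an associative algebra. -/

section Bracket

variable {A : Type*} [Ring A] (x y z : A)

theorem bracket_mul : ⁅x, y * z⁆ = ⁅x, y⁆ * z + y * ⁅x, z⁆ := by
  simp only [Ring.lie_def]; noncomm_ring

theorem mul_bracket : ⁅x * y, z⁆ = x * ⁅y, z⁆ + ⁅x, z⁆ * y := by
  simp only [Ring.lie_def]; noncomm_ring

theorem bracket_add : ⁅x, y + z⁆ = ⁅x, y⁆ + ⁅x, z⁆ := by
  simp only [Ring.lie_def]; noncomm_ring

theorem add_bracket : ⁅x + y, z⁆ = ⁅x, z⁆ + ⁅y, z⁆ := by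
  simp only [Ring.lie_def]; noncomm_ring

theorem bracket_swap : ⁅x, y⁆ = -⁅y, x⁆ := by
  simp only [Ring.lie_def]; noncomm_ring

theorem bracket_self : ⁅x, x⁆ = 0 := by
  simp only [Ring.lie_def]; noncomm_ring

theorem bracket_zero : ⁅x, (0 : A)⁆ = 0 := by
  simp [Ring.lie_def]

theorem zero_bracket : ⁅(0 : A), x⁆ = 0 := by
  simp [Ring.lie_def]

theorem bracket_one : ⁅x, (1 : A)⁆ = 0 := by
  simp [Ring.lie_def]

theorem one_bracket : ⁅(1 : A), x⁆ = 0 := by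
  simp [Ring.lie_def]

theorem mul_eq_mul_add_bracket : x * y = y * x + ⁅x, y⁆ := by
  simp only [Ring.lie_def]; noncomm_ring

variable {S : Type*} (s : Finset S) (f : S → A)

theorem bracket_sum : ⁅x, ∑ i ∈ s, f i⁆ = ∑ i ∈ s, ⁅x, f i⁆ := by
  simp [Ring.lie_def, Finset.mul_sum, Finset.sum_mul]

theorem sum_bracket : ⁅∑ i ∈ s, f i, x⁆ = ∑ i ∈ s, ⁅f i, x⁆ := by
  simp [Ring.lie_def, Finset.mul_sum, Finset.sum_mul]

variable [Algebra ℂ A] (c : ℂ)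

theorem bracket_smul : ⁅x, c • y⁆ = c • ⁅x, y⁆ := by
  simp [Ring.lie_def, smul_sub]

theorem smul_bracket : ⁅c • x, y⁆ = c • ⁅x, y⁆ := by
  simp [Ring.lie_def, smul_sub]

end Bracket

/-- `X` is a matrix with vanishing diagonal blocks (with respect to `p`) whose entries satisfy the
canonical commutation relations attached to the weight system `ω`. -/
structure IsWeylMatrix {J S A : Type*} [DecidableEq S] [Ring A] [Algebra ℂ A]
    (ω : WeightSystem J) (p : S → J) (X : S → S → A) : Prop where
  eq_zero : ∀ {e f}, p e = p f → X e f = 0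
  lie : ∀ e f k l, ⁅X e f, X k l⁆ =
    (if e = l then if f = k then -(ω.gap (p e) (p f))⁻¹ else 0 else 0 : ℂ) • (1 : A)

/-! ### The quantum moment map and covariance under it. -/

section Moment

variable {J S A : Type*} [Fintype S] [DecidableEq S] [Ring A] [Algebra ℂ A]
  (ω : WeightSystem J) (p : S → J) (X : S → S → A)

/-- The moment map `R = ∑ gap X X`. -/
def momentMatrix (e f : S) : A := ∑ j, ω.gap (p e) (p j) • (X e j * X j f)

/-- Covariance of a matrix `Z` under the adjoint action of the `(e, f)` entry of the moment map. -/
def IsCovariant (e f : S) (Z : S → S → A) : Prop :=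
  ∀ a b, ⁅momentMatrix ω p X e f, Z a b⁆ =
    (if a = f then Z e b else 0) - (if b = e then Z a f else 0)

variable {ω p X}

/-- The weights `gap` in R cancel the inverse gaps in the commutation relations up to sign. The
cancellation fails only where the gap is 0, and there the entry of X vanishes. -/
theorem IsWeylMatrix.isCovariant (h : IsWeylMatrix ω p X) {e f : S} (hef : p e = p f) :
    IsCovariant ω p X e f X := by
  intro a b
  simp only [momentMatrix, sum_bracket, smul_bracket, mul_bracket, h.lie, smul_add, mul_smul_comm,
    mul_one, smul_mul_assoc, one_mul, smul_smul, Finset.sum_add_distrib, mul_ite, mul_zero, ite_smul,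
    ite_mul, zero_mul, smul_ite, smul_zero, zero_smul, Finset.sum_ite_irrel, Finset.sum_ite_eq', Finset.sum_ite_eq, Finset.mem_univ,
    if_true, Finset.sum_const_zero]
  have hne : ∀ x y : J, x ≠ y → ω.gap x y * -(ω.gap y x)⁻¹ = 1 := fun x y hxy => by
    rw [ω.gap_swap y x, inv_neg, neg_neg, mul_inv_cancel₀ (ω.gap_ne_zero hxy)]
  have hne' : ∀ x y : J, x ≠ y → ω.gap x y * -(ω.gap x y)⁻¹ = -1 := fun x y hxy => by
    rw [mul_neg, mul_inv_cancel₀ (ω.gap_ne_zero hxy)]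
  have h1 : (if f = a then (ω.gap (p e) (p b) * -(ω.gap (p b) (p f))⁻¹) • X e b else 0) =
      if a = f then X e b else 0 := by
    simp only [eq_comm (a := f)]
    by_cases hb : p e = p b
    · simp [h.eq_zero hb]
    · rw [← hef, hne _ _ hb, one_smul]
  have h2 : (if e = b then (ω.gap (p e) (p a) * -(ω.gap (p e) (p a))⁻¹) • X a f else 0) =
      -if b = e then X a f else 0 := by
    simp only [eq_comm (a := e)]
    by_cases hb : p e = p a
    · simp [h.eq_zero (hb.symm.trans hef)]
    · rw [hne' _ _ hb, neg_one_smul]; split_ifs <;> simp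
  rw [sub_eq_add_neg, ← h1, ← h2]

theorem IsCovariant.schur {e f : S} (hef : p e = p f) {Z : S → S → A}
    (hZ : IsCovariant ω p X e f Z) (s : J → J → ℂ) :
    IsCovariant ω p X e f fun a b => s (p a) (p b) • Z a b := by
  intro a b
  rw [bracket_smul, hZ, smul_sub]
  split_ifs with h1 h2 <;> simp_all

/-- The terms acting on the inner index are ∓ Z a f * Z' e b, with weights `d e` and `d f`; they
cancel when these agree. -/
theorem IsCovariant.mul {e f : S} {d : S → ℂ} (hd : d e = d f) {Z Z' : S → S → A}
    (hZ : IsCovariant ω p X e f Z) (hZ' : IsCovariant ω p X e f Z') :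
    IsCovariant ω p X e f fun a b => ∑ l, d l • (Z a l * Z' l b) := by
  intro a b
  simp only [bracket_sum, bracket_smul, bracket_mul, hZ _ _, hZ' _ _, sub_mul, mul_sub, ite_mul,
    mul_ite, zero_mul, mul_zero, smul_add, smul_sub, smul_ite, smul_zero, Finset.sum_add_distrib,
    Finset.sum_sub_distrib, Finset.sum_ite_irrel, Finset.sum_ite_eq', Finset.sum_ite_eq,
    Finset.mem_univ, if_true, Finset.sum_const_zero, hd]
  abel

theorem IsWeylMatrix.isCovariant_momentMatrix (h : IsWeylMatrix ω p X) {e f : S}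
    (hef : p e = p f) : IsCovariant ω p X e f (momentMatrix ω p X) := by
  have := IsCovariant.mul (d := fun _ => 1) rfl ((h.isCovariant hef).schur hef ω.gap)
    (h.isCovariant hef)
  simp only [one_smul, smul_mul_assoc] at this
  exact this

theorem IsCovariant.bracket_trace {e f : S} {Z : S → S → A} (hZ : IsCovariant ω p X e f Z)
    (d : S → ℂ) :
    ⁅momentMatrix ω p X e f, ∑ c, d c • Z c c⁆ = (d f - d e) • Z e f := by
  simp [bracket_sum, bracket_smul, hZ _ _, smul_sub, sub_smul, Finset.sum_sub_distrib]

end Moment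

/-! ### Block Casimirs, braid relations and the commutation of the quartic parts. -/

section Casimir

variable {I J S A : Type*} [Fintype S] [DecidableEq S] [DecidableEq I] [Ring A]
  [Algebra ℂ A] (ω : WeightSystem J) (π : I → J) (node : S → I) (X : S → S → A)

/-- The indicator function of the indices lying over the node `i`. -/
def nodeIndicator (i : I) (e : S) : ℂ := (Pi.single i 1 : I → ℂ) (node e)

/-- The sum of the diagonal entries of `Z`, weighted by a function of the nodes. -/
def weightedTrace (d : I → ℂ) (Z : S → S → A) : A := ∑ c, d (node c) • Z c c

/-- The block Casimir element `∑ (R_{ef} R_{fe} + R_{ff})`, for `e` over `i` and `f` over `m`. -/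
def casimir (i m : I) : A :=
  ∑ e, ∑ f, (nodeIndicator node i e * nodeIndicator node m f) •
    (momentMatrix ω (π ∘ node) X e f * momentMatrix ω (π ∘ node) X f e +
      momentMatrix ω (π ∘ node) X f f)

/-- The sum `∑ (R_{ef} Z_{fe} - Z_{ef} R_{fe})`, for `e` over `i` and `f` over `m`. -/
def momentBracket (Z : S → S → A) (i m : I) : A :=
  ∑ e, ∑ f, (nodeIndicator node i e * nodeIndicator node m f) •
    (momentMatrix ω (π ∘ node) X e f * Z f e - Z e f * momentMatrix ω (π ∘ node) X f e)

variable {ω π node X}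

theorem nodeIndicator_smul_congr {i : I} {e : S} {x y : A} (h : node e = i → x = y) :
    nodeIndicator node i e • x = nodeIndicator node i e • y := by
  by_cases he : node e = i
  · rw [h he]
  · simp [nodeIndicator, Pi.single_apply, he]

theorem sum_nodeIndicator_congr {i m : I} {F G : S → S → A}
    (h : ∀ e f, node e = i → node f = m → F e f = G e f) :
    ∑ e, ∑ f, (nodeIndicator node i e * nodeIndicator node m f) • F e f =
      ∑ e, ∑ f, (nodeIndicator node i e * nodeIndicator node m f) • G e f := by
  refine Finset.sum_congr rfl fun e _ => Finset.sum_congr rfl fun f _ => ?_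
  rw [mul_smul, mul_smul]
  exact nodeIndicator_smul_congr fun he => nodeIndicator_smul_congr fun hf => h e f he hf

/-- Covariance of `Z` under the entries of the moment map over the nodes `i` and `m`. -/
def IsNodeCovariant (ω : WeightSystem J) (π : I → J) (node : S → I) (X : S → S → A) (i m : I)
    (Z : S → S → A) : Prop :=
  ∀ e f, (node e = i ∨ node e = m) → (node f = i ∨ node f = m) → IsCovariant ω (π ∘ node) X e f Z

theorem comp_eq_of_mem {i m : I} (him : π i = π m) {e f : S} (he : node e = i ∨ node e = m)
    (hf : node f = i ∨ node f = m) : (π ∘ node) e = (π ∘ node) f := by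
  rcases he with rfl | rfl <;> rcases hf with h | h <;> simp [h, him]

theorem IsWeylMatrix.isNodeCovariant (h : IsWeylMatrix ω (π ∘ node) X) {i m : I}
    (him : π i = π m) : IsNodeCovariant ω π node X i m X := fun _ _ he hf =>
  h.isCovariant (comp_eq_of_mem him he hf)

theorem IsNodeCovariant.schur {i m : I} (him : π i = π m) {Z : S → S → A}
    (hZ : IsNodeCovariant ω π node X i m Z) (s : J → J → ℂ) :
    IsNodeCovariant ω π node X i m fun a b => s (π (node a)) (π (node b)) • Z a b :=
  fun e f he hf => (hZ e f he hf).schur (comp_eq_of_mem him he hf) s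

theorem IsNodeCovariant.mul {i m : I} {d : I → ℂ} (hd : d i = d m) {Z Z' : S → S → A}
    (hZ : IsNodeCovariant ω π node X i m Z) (hZ' : IsNodeCovariant ω π node X i m Z') :
    IsNodeCovariant ω π node X i m fun a b => ∑ l, d (node l) • (Z a l * Z' l b) :=
  fun e f he hf => (hZ e f he hf).mul (d := d ∘ node) (by
    rcases he with he | he <;> rcases hf with hf | hf <;> simp [he, hf, hd]) (hZ' e f he hf)

theorem IsWeylMatrix.isNodeCovariant_momentMatrix (h : IsWeylMatrix ω (π ∘ node) X) {i m : I}
    (him : π i = π m) : IsNodeCovariant ω π node X i m (momentMatrix ω (π ∘ node) X) :=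
  fun _ _ he hf => h.isCovariant_momentMatrix (comp_eq_of_mem him he hf)

/-- A node-weighted trace fails to be invariant under R_ef only by the difference of the weights at
the nodes of e and f. The summand R_ff has both indices over m and drops out. -/
theorem IsNodeCovariant.casimir_bracket {i m : I} {Z : S → S → A}
    (hZ : IsNodeCovariant ω π node X i m Z) (d : I → ℂ) :
    ⁅casimir ω π node X i m, weightedTrace node d Z⁆ =
      (d i - d m) • momentBracket ω π node X Z i m := by
  rw [casimir, momentBracket]
  simp only [sum_bracket, smul_bracket, Finset.smul_sum, smul_comm (d i - d m)]
  refine sum_nodeIndicator_congr fun e f he hf => ?_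
  have h (e f) (he) (hf) := (hZ e f he hf).bracket_trace (d ∘ node)
  simp only [Function.comp_apply] at h
  rw [add_bracket, mul_bracket, weightedTrace, h e f (.inl he) (.inr hf),
    h f e (.inr hf) (.inl he), h f f (.inr hf) (.inr hf), sub_self, zero_smul, add_zero, he, hf,
    mul_smul_comm, smul_mul_assoc]
  module

/-- By covariance [R_ef, Z_fe] = Z_ee - Z_ff, which cancels [R_fe, Z_ef]. -/
theorem IsNodeCovariant.momentBracket_swap {i m : I} {Z : S → S → A}
    (hZ : IsNodeCovariant ω π node X i m Z) :
    momentBracket ω π node X Z i m = -momentBracket ω π node X Z m i := by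
  rw [← add_eq_zero_iff_eq_neg]
  have : momentBracket ω π node X Z m i =
      ∑ e, ∑ f, (nodeIndicator node i e * nodeIndicator node m f) •
    (momentMatrix ω (π ∘ node) X f e * Z e f - Z f e * momentMatrix ω (π ∘ node) X e f) := by
    rw [momentBracket, Finset.sum_comm]
    simp only [mul_comm (nodeIndicator node m _)]
  rw [this, momentBracket, ← Finset.sum_add_distrib]
  simp only [← Finset.sum_add_distrib, ← smul_add]
  have h0 : ∑ e : S, ∑ f : S, (nodeIndicator node i e * nodeIndicator node m f) • (0 : A) = 0 := by
    simp
  rw [← h0]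
  refine sum_nodeIndicator_congr fun e f he hf => ?_
  have h1 := hZ e f (.inl he) (.inr hf) f e
  have h2 := hZ f e (.inr hf) (.inl he) e f
  simp only [if_true] at h1 h2
  calc _ = ⁅momentMatrix ω (π ∘ node) X e f, Z f e⁆ + ⁅momentMatrix ω (π ∘ node) X f e, Z e f⁆ := by
        simp only [Ring.lie_def]; abel
    _ = 0 := by rw [h1, h2]; abel

theorem IsNodeCovariant.momentBracket_self {i : I} {Z : S → S → A}
    (hZ : IsNodeCovariant ω π node X i i Z) : momentBracket ω π node X Z i i = 0 := by
  have h : (2 : ℂ) • momentBracket ω π node X Z i i = 0 := by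
    rw [two_smul]; nth_rw 1 [hZ.momentBracket_swap]; abel
  exact (smul_eq_zero.1 h).resolve_left two_ne_zero

/-- Since [R_ef, R_fe] = R_ee - R_ff, adding R_ff to R_ef R_fe is exactly the correction that makes
the sum symmetric. -/
theorem IsWeylMatrix.casimir_swap (h : IsWeylMatrix ω (π ∘ node) X) {i m : I} (him : π i = π m) :
    casimir ω π node X i m = casimir ω π node X m i := by
  rw [casimir, casimir, Finset.sum_comm]
  simp only [mul_comm (nodeIndicator node i _)]
  refine sum_nodeIndicator_congr fun e f he hf => ?_
  have h1 := h.isNodeCovariant_momentMatrix him f e (.inl hf) (.inr he) e f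
  simp only [if_true] at h1
  rw [mul_eq_mul_add_bracket, h1]
  abel

/-- A combination of Casimirs becomes two node-weighted traces of covariant matrices, to which
`casimir_bracket` applies. -/
theorem sum_smul_casimir [Fintype I] (d : I → ℂ) (j : I) :
    ∑ n, d n • casimir ω π node X j n =
      weightedTrace node (Pi.single j 1) (fun a b => ∑ c, d (node c) •
        (momentMatrix ω (π ∘ node) X a c * momentMatrix ω (π ∘ node) X c b)) +
      (∑ f, nodeIndicator node j f) • weightedTrace node d (momentMatrix ω (π ∘ node) X) := by
  rw [Finset.sum_smul]
  simp only [casimir, weightedTrace, Finset.smul_sum]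
  rw [Finset.sum_comm, ← Finset.sum_add_distrib]
  refine Finset.sum_congr rfl fun e _ => ?_
  rw [Finset.sum_comm, ← Finset.sum_add_distrib]
  refine Finset.sum_congr rfl fun f _ => ?_
  rw [Finset.sum_eq_single (node f)]
  · simp only [nodeIndicator, Pi.single_eq_same]
    module
  · intro n _ hn
    simp [nodeIndicator, Pi.single_apply, hn.symm]
  · simp

/-- Both traces have equal weights at i and m. Taking for `d` the indicator of a node outside {i,
m}, or that of {i, m}, gives the two kinds of infinitesimal braid relations below. -/
theorem IsWeylMatrix.casimir_bracket_sum_casimir [Fintype I] (h : IsWeylMatrix ω (π ∘ node) X)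
    {i m j : I} (him : π i = π m) (hi : j ≠ i) (hm : j ≠ m) {d : I → ℂ} (hd : d i = d m) :
    ⁅casimir ω π node X i m, ∑ n, d n • casimir ω π node X j n⁆ = 0 := by
  have hR := h.isNodeCovariant_momentMatrix him
  rw [sum_smul_casimir, bracket_add, bracket_smul, hR.casimir_bracket,
    (hR.mul hd hR).casimir_bracket, hd, Pi.single_eq_of_ne hi.symm, Pi.single_eq_of_ne hm.symm]
  simp

theorem IsWeylMatrix.casimir_bracket_casimir [Fintype I] (h : IsWeylMatrix ω (π ∘ node) X)
    {i m j n : I} (him : π i = π m) (hji : j ≠ i) (hjm : j ≠ m) (hni : n ≠ i) (hnm : n ≠ m) :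
    ⁅casimir ω π node X i m, casimir ω π node X j n⁆ = 0 := by
  have := h.casimir_bracket_sum_casimir him hji hjm (d := Pi.single n 1)
    (by rw [Pi.single_eq_of_ne hni.symm, Pi.single_eq_of_ne hnm.symm])
  simpa [Pi.single_apply, ite_smul] using this

theorem IsWeylMatrix.kohno [Fintype I] (h : IsWeylMatrix ω (π ∘ node) X)
    {i m j : I} (him : π i = π m) (hne : i ≠ m) (hji : j ≠ i) (hjm : j ≠ m) :
    ⁅casimir ω π node X i m, casimir ω π node X j i⁆ =
      -⁅casimir ω π node X i m, casimir ω π node X j m⁆ := by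
  have := h.casimir_bracket_sum_casimir him hji hjm (d := Pi.single i 1 + Pi.single m 1)
    (by simp [hne, hne.symm])
  rw [← add_eq_zero_iff_eq_neg, ← bracket_add]
  simpa [Pi.single_apply, ite_smul, add_smul, Finset.sum_add_distrib] using this

/-- The times part of the Hamiltonians: the differences of times attached to pairs of distinct nodes
in the same part. -/
def timeWeight (π : I → J) [DecidableEq J] (t : I → ℂ) (i m : I) : ℂ :=
  if π m = π i ∧ m ≠ i then (t i - t m)⁻¹ else 0

variable [DecidableEq J]

theorem timeWeight_swap (t : I → ℂ) (i m : I) : timeWeight π t i m = -timeWeight π t m i := by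
  simp only [timeWeight, eq_comm (a := π m), ne_comm (a := m)]
  split_ifs
  · rw [← inv_neg, neg_sub]
  · simp

theorem timeWeight_self (t : I → ℂ) (i : I) : timeWeight π t i i = 0 := by
  simp [timeWeight]

theorem timeWeight_of_ne (t : I → ℂ) {i m : I} (h : π m ≠ π i) : timeWeight π t i m = 0 := by
  simp [timeWeight, h]

/-- Brackets of Casimirs of disjoint pairs vanish. The rest are grouped by the third node n: there
the braid relations leave a single bracket, whose coefficient vanishes by the Arnold relation. -/
theorem IsWeylMatrix.quartic_bracket_quartic [Fintype I] (h : IsWeylMatrix ω (π ∘ node) X)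
    {t : I → ℂ} (ht : t ∈ timeSpace π) {i j : I} (hij : i ≠ j) :
    ⁅∑ m, timeWeight π t i m • casimir ω π node X i m,
      ∑ n, timeWeight π t j n • casimir ω π node X j n⁆ = 0 := by
  set r := timeWeight π t with hr
  set E := casimir ω π node X with hE
  set F : I → I → A := fun m n => (r i m * r j n) • ⁅E i m, E j n⁆ with hF
  have hsum : ⁅∑ m, r i m • E i m, ∑ n, r j n • E j n⁆ = ∑ m, ∑ n, F m n := by
    rw [sum_bracket]
    refine Finset.sum_congr rfl fun m _ => ?_
    simp only [bracket_sum, smul_bracket, bracket_smul, hF, smul_smul, Finset.smul_sum,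
      mul_comm (r j _)]
  have hzero : ∀ m n, m ≠ j → n ≠ i → m ≠ n → F m n = 0 := by
    intro m n hmj hni hmn
    by_cases him : π m = π i
    · rw [hF]; dsimp only
      rw [h.casimir_bracket_casimir him.symm hij.symm hmj.symm hni hmn.symm, smul_zero]
    · simp [hF, hr, timeWeight_of_ne t him]
  have hii : ∀ n, F i n = 0 := fun n => by simp [hF, hr, timeWeight_self]
  have hjj : ∀ m, F m j = 0 := fun n => by simp [hF, hr, timeWeight_self]
  have hji : F j i = 0 := by
    by_cases hp : π i = π j
    · simp only [hF, hE]; rw [h.casimir_swap hp, bracket_self, smul_zero]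
    · simp [hF, hr, timeWeight_of_ne t hp]
  -- The three indicators overlap only at (j, i), (j, j) and (i, i), where F vanishes, so double
  -- counting is harmless.
  have hsplit : ∀ m n, F m n = (if m = j then F j n else 0) + (if n = i then F m i else 0) +
      (if m = n then F n n else 0) := by
    intro m n
    by_cases h1 : m = j
    · subst h1
      by_cases h2 : n = i
      · subst h2; simp [hji, hij.symm]
      · by_cases h3 : m = n
        · subst h3; simp [hjj, h2]
        · simp [h2, h3]
    · by_cases h2 : n = i
      · subst h2
        by_cases h3 : m = n
        · subst h3; simp [hii, h1]
        · simp [h1, h3]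
      · by_cases h3 : m = n
        · simp [h1, h2, h3]
          intro h4; exact absurd (h3.trans h4) h1
        · simp [h1, h2, h3, hzero m n h1 h2 h3]
  have hthree : ∀ n, F j n + F n i + F n n = 0 := by
    intro n
    by_cases h1 : n = i
    · subst h1; simp [hji, hii]
    by_cases h2 : n = j
    · subst h2; simp [hji, hjj]
    by_cases hp : π i = π j
    swap
    · have hp' : π j ≠ π i := fun e => hp e.symm
      have h3 : r i n * r j n = 0 := by
        by_cases h4 : π n = π i
        · rw [hr, timeWeight_of_ne t (m := n) (i := j) (h4 ▸ hp), mul_zero]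
        · rw [hr, timeWeight_of_ne t h4, zero_mul]
      simp only [hF, h3, zero_smul]
      simp [hr, timeWeight_of_ne t hp, timeWeight_of_ne t hp']
    by_cases hq : π n = π i
    swap
    · have hq' : π n ≠ π j := hp ▸ hq
      simp [hF, hr, timeWeight_of_ne t hq, timeWeight_of_ne t hq']
    have e1 : ⁅E i n, E j i⁆ = ⁅E i j, E j n⁆ := by
      rw [bracket_swap, hE, h.casimir_swap hp.symm, h.casimir_swap hq.symm,
        h.kohno hp hij h1 h2, h.casimir_swap (hq.trans hp), neg_neg]
    have e2 : ⁅E i n, E j n⁆ = -⁅E i j, E j n⁆ := by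
      rw [bracket_swap, hE, bracket_swap (casimir ω π node X i j), neg_neg, neg_eq_iff_eq_neg]
      exact neg_eq_iff_eq_neg.1 (h.kohno (hq.trans hp).symm (Ne.symm h2) hij (Ne.symm h1)).symm
    simp only [hF, e1, e2, smul_neg, ← neg_smul, ← add_smul]
    have h3 : r i j * r j n + r i n * r j i + -(r i n * r j n) = 0 := by
      have a1 : t i - t j ≠ 0 := sub_ne_zero.2 (ht _ _ hij hp)
      have a2 : t i - t n ≠ 0 := sub_ne_zero.2 (ht _ _ (Ne.symm h1) hq.symm)
      have a3 : t j - t n ≠ 0 := sub_ne_zero.2 (ht _ _ (Ne.symm h2) (hq.trans hp).symm)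
      have a4 : t j - t i ≠ 0 := sub_ne_zero.2 (ht _ _ hij.symm hp.symm)
      simp only [hr, timeWeight, hp, hq, hij, hij.symm, h1, h2, ne_eq, not_false_eq_true, and_self,
        if_true]
      field_simp
      ring
    rw [h3, zero_smul]
  rw [hsum]
  have : ∑ m, ∑ n, F m n = ∑ n, (F j n + F n i + F n n) := by
    rw [Finset.sum_congr rfl fun m _ => Finset.sum_congr rfl fun n _ => hsplit m n]
    simp only [Finset.sum_add_distrib, Finset.sum_ite_irrel, Finset.sum_const_zero,
      Finset.sum_ite_eq, Finset.sum_ite_eq', Finset.mem_univ, if_true]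
  rw [this]
  exact Finset.sum_eq_zero fun n _ => hthree n

end Casimir

/-! ### Brackets of the cubic elements. -/

section Cubic

variable {J S A : Type*} [Fintype S] [DecidableEq S] [Ring A] [Algebra ℂ A]
  {ω : WeightSystem J} {p : S → J} {X : S → S → A}

/-- Only transposed entries can fail to commute, and inside one part their constant is `-(0)⁻¹ = 0`.
-/
theorem IsWeylMatrix.entry_mul_comm (h : IsWeylMatrix ω p X) {e f k l : S}
    (hne : e = l → f = k → p e = p f) : X e f * X k l = X k l * X e f := by
  rw [mul_eq_mul_add_bracket, h.lie]
  split_ifs with h1 h2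
  · rw [hne h1 h2, ω.gap_self]; simp
  · simp
  · simp

theorem WeightSystem.gap_mul_neg_inv (ω : WeightSystem J) [DecidableEq J] (x y : J) :
    ω.gap x y * -(ω.gap x y)⁻¹ = if x = y then 0 else -1 := by
  split_ifs with h
  · simp [h, ω.gap_self]
  · rw [mul_neg, mul_inv_cancel₀ (ω.gap_ne_zero h)]

theorem WeightSystem.gap_mul_neg_inv_swap (ω : WeightSystem J) [DecidableEq J] (x y : J) :
    ω.gap x y * -(ω.gap y x)⁻¹ = if x = y then 0 else 1 := by
  rw [ω.gap_swap x y, neg_mul, ω.gap_mul_neg_inv]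
  simp only [eq_comm (a := y)]
  split_ifs <;> simp

variable (ω p X) in
/-- The matrix of weighted sums of products of three entries of `X`. -/
def cubicMatrix (e f : S) : A :=
  ∑ l, ∑ k, ω.gap (p k) (p l) • (X e l * X l k * X k f)

theorem IsWeylMatrix.cubic_bracket [DecidableEq J] (h : IsWeylMatrix ω p X) (e a b : S) :
    ⁅cubicMatrix ω p X e e, X a b⁆ = (if p a = p b then 0 else X a e * X e b) +
      (if b = e then ∑ k, (ω.gap (p k) (p a) * -(ω.gap (p e) (p a))⁻¹) • (X a k * X k e) else 0) +
      (if a = e then ∑ l, (ω.gap (p b) (p l) * -(ω.gap (p b) (p e))⁻¹) • (X e l * X l b)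
        else 0) := by
  have hmid : (ω.gap (p a) (p b) * -(ω.gap (p b) (p a))⁻¹) • (X e b * X a e) =
      if p a = p b then 0 else X a e * X e b := by
    rw [ω.gap_mul_neg_inv_swap]
    split_ifs with hab
    · rw [zero_smul]
    · rw [one_smul, h.entry_mul_comm fun _ hba => absurd (congrArg p hba.symm) hab]
  rw [← hmid, cubicMatrix]
  simp only [sum_bracket, smul_bracket, mul_bracket, h.lie, mul_add, add_mul, smul_add,
    Finset.sum_add_distrib, mul_ite, ite_mul, ite_smul, smul_ite, zero_smul, mul_zero, zero_mul,
    smul_zero, mul_smul_comm, smul_mul_assoc, mul_one, one_mul, smul_smul, Finset.sum_ite_irrel,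
    Finset.sum_ite_eq', Finset.sum_ite_eq, Finset.mem_univ, if_true, Finset.sum_const_zero,
    eq_comm (a := e)]
  abel

/-- The Leibniz rule over the three factors of the second element yields closed quartic paths
through e and f. In the first family e is opposite to f; in the other two they are adjacent. -/
theorem IsWeylMatrix.cubic_bracket_cubic [DecidableEq J] (h : IsWeylMatrix ω p X) {e f : S}
    (hef : e ≠ f) :
    ⁅cubicMatrix ω p X e e, cubicMatrix ω p X f f⁆ =
      ∑ l, ∑ k, (ω.gap (p k) (p l) + ω.gap (p k) (p e) * (ω.gap (p l) (p f) *
        -(ω.gap (p e) (p f))⁻¹) + ω.gap (p e) (p l) * (ω.gap (p f) (p k) *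
        -(ω.gap (p f) (p e))⁻¹)) • (X f l * X l e * X e k * X k f) +
      ∑ l, ∑ k, (ω.gap (p k) (p l) * ((if p k = p e then 1 else 0) - if p l = p f then 1 else 0)) •
        (X f e * X e l * X l k * X k f) +
      ∑ l, ∑ k, (ω.gap (p k) (p l) * ((if p l = p e then 1 else 0) - if p k = p f then 1 else 0)) •
        (X f l * X l k * X k e * X e f) := by
  have hA : ∑ l, ∑ k, ω.gap (p k) (p l) •
      (⁅cubicMatrix ω p X e e, X f l⁆ * X l k * X k f) =
      ∑ l, ∑ k, (ω.gap (p k) (p l) * if p l = p f then 0 else 1) •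
        (X f e * X e l * X l k * X k f) +
      ∑ l, ∑ k, (ω.gap (p k) (p e) * (ω.gap (p l) (p f) * -(ω.gap (p e) (p f))⁻¹)) •
        (X f l * X l e * X e k * X k f) := by
    rw [Finset.sum_comm (f := fun l k => (ω.gap (p k) (p e) * (ω.gap (p l) (p f) *
      -(ω.gap (p e) (p f))⁻¹)) • (X f l * X l e * X e k * X k f))]
    simp only [h.cubic_bracket, if_neg hef.symm, add_zero, add_mul, smul_add, ite_mul, smul_ite,
      zero_mul, smul_zero, Finset.sum_add_distrib, mul_ite, ite_smul, mul_zero, zero_smul, mul_one,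
      Finset.sum_ite_irrel, Finset.sum_ite_eq', Finset.sum_ite_eq, Finset.mem_univ, if_true,
      Finset.sum_const_zero, Finset.sum_mul, Finset.smul_sum, smul_mul_assoc, smul_smul,
      eq_comm (a := p f)]
  have hB : ∑ l, ∑ k, ω.gap (p k) (p l) •
      (X f l * ⁅cubicMatrix ω p X e e, X l k⁆ * X k f) =
      ∑ l, ∑ k, ω.gap (p k) (p l) • (X f l * X l e * X e k * X k f) +
      ∑ l, ∑ k, (ω.gap (p k) (p l) * (ω.gap (p e) (p l) * -(ω.gap (p e) (p l))⁻¹)) •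
        (X f l * X l k * X k e * X e f) +
      ∑ l, ∑ k, (ω.gap (p k) (p l) * (ω.gap (p k) (p e) * -(ω.gap (p k) (p e))⁻¹)) •
        (X f e * X e l * X l k * X k f) := by
    have h0 : ∀ l k, ω.gap (p k) (p l) • (if p l = p k then 0 else X f l * X l e * X e k * X k f) =
        ω.gap (p k) (p l) • (X f l * X l e * X e k * X k f) := by
      intro l k
      split_ifs with hlk
      · rw [hlk, ω.gap_self, zero_smul, zero_smul]
      · rfl
    rw [Finset.sum_comm (f := fun l k => (ω.gap (p k) (p l) * (ω.gap (p k) (p e) *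
      -(ω.gap (p k) (p e))⁻¹)) • (X f e * X e l * X l k * X k f))]
    simp only [h.cubic_bracket, mul_add, add_mul, smul_add, ite_mul, mul_ite,
      zero_mul, mul_zero, Finset.sum_add_distrib, ← mul_assoc, h0]
    simp only [smul_ite, smul_zero,
      Finset.sum_ite_irrel, Finset.sum_ite_eq', Finset.sum_ite_eq, Finset.mem_univ, if_true,
      Finset.sum_const_zero, Finset.sum_mul, Finset.mul_sum, Finset.smul_sum, smul_mul_assoc,
      mul_smul_comm, smul_smul, ← mul_assoc]
    congr 1
    · congr 1
      refine Finset.sum_congr rfl fun l _ => Finset.sum_congr rfl fun k _ => ?_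
      congr 1; ring
    · refine Finset.sum_congr rfl fun l _ => Finset.sum_congr rfl fun k _ => ?_
      congr 1; ring
  have hC : ∑ l, ∑ k, ω.gap (p k) (p l) •
      (X f l * X l k * ⁅cubicMatrix ω p X e e, X k f⁆) =
      ∑ l, ∑ k, (ω.gap (p k) (p l) * if p k = p f then 0 else 1) •
        (X f l * X l k * X k e * X e f) +
      ∑ l, ∑ k, (ω.gap (p e) (p l) * (ω.gap (p f) (p k) * -(ω.gap (p f) (p e))⁻¹)) •
        (X f l * X l e * X e k * X k f) := by
    simp only [h.cubic_bracket, if_neg hef.symm, add_zero, mul_add, smul_add, ite_mul, smul_ite,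
      zero_mul, smul_zero, Finset.sum_add_distrib, mul_ite, ite_smul, mul_zero, zero_smul, mul_one,
      Finset.sum_ite_irrel, Finset.sum_ite_eq', Finset.sum_ite_eq, Finset.mem_univ, if_true,
      Finset.sum_const_zero, Finset.mul_sum, Finset.smul_sum, mul_smul_comm, smul_smul,
      ← mul_assoc]
  have hsum : ⁅cubicMatrix ω p X e e, cubicMatrix ω p X f f⁆ =
      ∑ l, ∑ k, ω.gap (p k) (p l) • (⁅cubicMatrix ω p X e e, X f l⁆ * X l k * X k f) +
      ∑ l, ∑ k, ω.gap (p k) (p l) • (X f l * ⁅cubicMatrix ω p X e e, X l k⁆ * X k f) +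
      ∑ l, ∑ k, ω.gap (p k) (p l) • (X f l * X l k * ⁅cubicMatrix ω p X e e, X k f⁆) := by
    conv_lhs => rw [cubicMatrix.eq_def ω p X f f]
    simp only [bracket_sum, bracket_smul, bracket_mul, ← Finset.sum_add_distrib, ← smul_add,
      add_mul, add_assoc]
  rw [hsum, hA, hB, hC]
  simp only [← Finset.sum_add_distrib]
  refine Finset.sum_congr rfl fun l _ => Finset.sum_congr rfl fun k _ => ?_
  rw [ω.gap_mul_neg_inv, ω.gap_mul_neg_inv]
  have e1 : (if p l = p e then (1 : ℂ) else 0) - (if p k = p f then 1 else 0) =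
      (if p k = p f then 0 else 1) + if p e = p l then 0 else -1 := by
    simp only [eq_comm (a := p e)]; split_ifs <;> simp
  have e2 : (if p k = p e then (1 : ℂ) else 0) - (if p l = p f then 1 else 0) =
      (if p l = p f then 0 else 1) + if p k = p e then 0 else -1 := by
    split_ifs <;> simp
  rw [e1, e2]
  module

/-- Here X_ef, X_fe and gap (p e) (p f), with its inverse, all vanish. Only the first family
survives, with weight gap (p k) (p l). The identity `gap_eq` based at the common part splits this
weight into the products of gap and slope on the right. -/
theorem IsWeylMatrix.cubic_bracket_cubic_of_eq (h : IsWeylMatrix ω p X) {e f : S}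
    (hef : e ≠ f) (hp : p e = p f) :
    ⁅cubicMatrix ω p X e e, cubicMatrix ω p X f f⁆ =
      -(momentMatrix ω p X e f * (∑ l, ω.slope (p e) (p l) • (X f l * X l e)) -
        (∑ l, ω.slope (p e) (p l) • (X e l * X l f)) * momentMatrix ω p X f e) := by
  classical
  have hcomm : ∀ l k, l ≠ k → X f l * X l e * X e k * X k f = X e k * X k f * X f l * X l e := by
    intro l k hlk
    have c1 : X l e * X e k = X e k * X l e := h.entry_mul_comm fun h1 => absurd h1 hlk
    have c2 : X f l * X e k = X e k * X f l := h.entry_mul_comm fun h1 h2 => h2 ▸ hp.symm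
    have c3 : X l e * X k f = X k f * X l e := h.entry_mul_comm fun h1 h2 => by rw [h1, hp]
    have c4 : X f l * X k f = X k f * X f l := h.entry_mul_comm fun _ h2 => absurd h2 hlk
    calc X f l * X l e * X e k * X k f = X f l * (X l e * X e k) * X k f := by noncomm_ring
      _ = X f l * X e k * (X l e * X k f) := by rw [c1]; noncomm_ring
      _ = X e k * (X f l * X k f) * X l e := by rw [c2, c3]; noncomm_ring
      _ = _ := by rw [c4]; noncomm_ring
  have hfe : X f e = 0 := h.eq_zero hp.symm
  have hfe' : X e f = 0 := h.eq_zero hp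
  rw [h.cubic_bracket_cubic hef, hfe, hfe', hp, ω.gap_self]
  simp only [zero_mul, mul_zero, smul_zero, Finset.sum_const_zero, add_zero, inv_zero, neg_zero]
  simp only [momentMatrix, Finset.sum_mul, Finset.mul_sum, smul_mul_assoc, mul_smul_comm,
    smul_smul, Finset.smul_sum]
  rw [← Finset.sum_sub_distrib, ← Finset.sum_neg_distrib]
  refine Finset.sum_congr rfl fun l _ => ?_
  rw [← Finset.sum_sub_distrib, ← Finset.sum_neg_distrib]
  refine Finset.sum_congr rfl fun k _ => ?_
  by_cases hl : p l = p f
  · simp [h.eq_zero hl.symm]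
  by_cases hk : p k = p f
  · simp [h.eq_zero (hp.trans hk.symm), h.eq_zero hk]
  -- For l = k the monomials cannot be reordered, but the left coefficient is 0 and the two terms on
  -- the right coincide.
  by_cases hlk : l = k
  · subst hlk
    simp only [hp, ω.gap_self, zero_smul]
    rw [mul_comm (ω.gap _ _), sub_self, neg_zero]
  · rw [hcomm l k hlk, hp, ω.gap_eq hk hl]
    simp only [mul_assoc]
    module

/-- The Plücker relation kills the family with e opposite to f. In the others the indicators confine
one index to the part of e or f, and the sum over the free index assembles an entry of R. -/
theorem IsWeylMatrix.cubic_bracket_cubic_of_ne [DecidableEq J] (h : IsWeylMatrix ω p X) {e f : S}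
    (hp : p e ≠ p f) :
    ⁅cubicMatrix ω p X e e, cubicMatrix ω p X f f⁆ =
      (∑ k, if p k = p e then momentMatrix ω p X e k * (X k f * X f e) -
        X e f * X f k * momentMatrix ω p X k e else 0) -
      ∑ l, if p l = p f then momentMatrix ω p X f l * (X l e * X e f) -
        X f e * X e l * momentMatrix ω p X l f else 0 := by
  have hne : e ≠ f := fun hef => hp (congrArg p hef)
  have hg := ω.gap_ne_zero hp
  have hcoeff : ∀ l k, (ω.gap (p k) (p l) + ω.gap (p k) (p e) * (ω.gap (p l) (p f) *
        -(ω.gap (p e) (p f))⁻¹) + ω.gap (p e) (p l) * (ω.gap (p f) (p k) *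
        -(ω.gap (p f) (p e))⁻¹)) = 0 := by
    intro l k
    have := ω.plucker (p e) (p f) (p k) (p l)
    rw [ω.gap_swap (p f) (p e), ω.gap_swap (p k) (p e), ω.gap_swap (p l) (p f), inv_neg]
    field_simp
    linear_combination this
  -- Moving R inward costs X f k * X k f in both terms, which cancels. Scalar commutators occur only
  -- for k = e, where they agree.
  have hswap : ∀ k, p k = p e → momentMatrix ω p X e k * (X k f * X f e) -
        X e f * X f k * momentMatrix ω p X k e =
      X f e * momentMatrix ω p X e k * X k f - X f k * momentMatrix ω p X k e * X e f := by
    intro k hk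
    have c1 := h.isCovariant (e := e) (f := k) hk.symm f e
    have c2 := h.isCovariant (e := k) (f := e) hk e f
    have hkf : p k ≠ p f := hk ▸ hp
    rw [if_neg (fun hh => hkf (congrArg p hh.symm)), if_pos rfl, zero_sub, Ring.lie_def] at c1
    rw [if_pos rfl, if_neg (fun hh => hkf (congrArg p hh.symm)), sub_zero, Ring.lie_def] at c2
    have c3 := mul_eq_mul_add_bracket (X k f) (X f e)
    have c4 := mul_eq_mul_add_bracket (X e f) (X f k)
    have c5 : momentMatrix ω p X e k * ⁅X k f, X f e⁆ =
        ⁅X e f, X f k⁆ * momentMatrix ω p X k e := by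
      rw [h.lie, h.lie]
      by_cases hke : k = e
      · subst hke; simp
      · simp [hke, Ne.symm hke]
    rw [c3, c4, mul_add, add_mul, c5, add_sub_add_right_eq_sub, ← mul_assoc,
      eq_add_of_sub_eq c1, mul_assoc (X f k), mul_assoc (X f k), eq_add_of_sub_eq c2]
    noncomm_ring
  have hterm1 : ∀ l k, (ω.gap (p k) (p l) * ((if p k = p e then 1 else 0) -
      if p l = p f then 1 else 0)) • (X f e * X e l * X l k * X k f) =
      (if p k = p e then ω.gap (p e) (p l) • (X f e * (X e l * X l k) * X k f) else 0) +
      (if p l = p f then ω.gap (p l) (p k) • (X f e * X e l * (X l k * X k f)) else 0) := by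
    intro l k
    rw [mul_sub, sub_smul, sub_eq_add_neg]
    congr 1
    · split_ifs with hk <;> simp [*, mul_assoc]
    · split_ifs with hl
      · rw [ω.gap_swap]; simp [mul_assoc]
      · simp
  have hterm2 : ∀ l k, (ω.gap (p k) (p l) * ((if p l = p e then 1 else 0) -
      if p k = p f then 1 else 0)) • (X f l * X l k * X k e * X e f) =
      -(if p l = p e then ω.gap (p l) (p k) • (X f l * (X l k * X k e) * X e f) else 0) -
      (if p k = p f then ω.gap (p f) (p l) • (X f l * X l k * (X k e * X e f)) else 0) := by
    intro l k
    rw [mul_sub, sub_smul]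
    congr 1
    · split_ifs with hk
      · rw [ω.gap_swap]; simp [mul_assoc]
      · simp
    · split_ifs with hl
      · simp [hl, mul_assoc]
      · simp
  rw [h.cubic_bracket_cubic hne]
  simp only [hcoeff, zero_smul, Finset.sum_const_zero, zero_add, hterm1, hterm2,
    Finset.sum_add_distrib, Finset.sum_sub_distrib, Finset.sum_neg_distrib]
  have h1 : ∑ l, ∑ k, (if p k = p e then ω.gap (p e) (p l) • (X f e * (X e l * X l k) * X k f)
      else 0) = ∑ k, if p k = p e then X f e * momentMatrix ω p X e k * X k f else 0 := by
    rw [Finset.sum_comm]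
    simp only [momentMatrix, Finset.mul_sum, Finset.sum_mul, mul_smul_comm, smul_mul_assoc,
      Finset.sum_ite_irrel, Finset.sum_const_zero]
  have h2 : ∑ l, ∑ k, (if p l = p f then ω.gap (p l) (p k) • (X f e * X e l * (X l k * X k f))
      else 0) = ∑ l, if p l = p f then X f e * X e l * momentMatrix ω p X l f else 0 := by
    simp only [momentMatrix, Finset.mul_sum, Finset.sum_mul, mul_smul_comm, smul_mul_assoc,
      Finset.sum_ite_irrel, Finset.sum_const_zero]
  have h3 : ∑ l, ∑ k, (if p l = p e then ω.gap (p l) (p k) • (X f l * (X l k * X k e) * X e f)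
      else 0) = ∑ k, if p k = p e then X f k * momentMatrix ω p X k e * X e f else 0 := by
    simp only [momentMatrix, Finset.mul_sum, Finset.sum_mul, mul_smul_comm, smul_mul_assoc,
      Finset.sum_ite_irrel, Finset.sum_const_zero]
  have h4 : ∑ l, ∑ k, (if p k = p f then ω.gap (p f) (p l) • (X f l * X l k * (X k e * X e f))
      else 0) = ∑ k, if p k = p f then momentMatrix ω p X f k * (X k e * X e f) else 0 := by
    rw [Finset.sum_comm]
    simp only [momentMatrix, Finset.mul_sum, Finset.sum_mul, mul_smul_comm, smul_mul_assoc,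
      Finset.sum_ite_irrel, Finset.sum_const_zero]
  have h5 : (∑ k, if p k = p e then momentMatrix ω p X e k * (X k f * X f e) -
        X e f * X f k * momentMatrix ω p X k e else 0) =
      (∑ k, if p k = p e then X f e * momentMatrix ω p X e k * X k f else 0) -
        ∑ k, if p k = p e then X f k * momentMatrix ω p X k e * X e f else 0 := by
    rw [← Finset.sum_sub_distrib]
    refine Finset.sum_congr rfl fun k _ => ?_
    split_ifs with hk
    · exact hswap k hk
    · rw [sub_zero]
  have h6 : (∑ l, if p l = p f then momentMatrix ω p X f l * (X l e * X e f) -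
        X f e * X e l * momentMatrix ω p X l f else 0) =
      (∑ k, if p k = p f then momentMatrix ω p X f k * (X k e * X e f) else 0) -
        ∑ l, if p l = p f then X f e * X e l * momentMatrix ω p X l f else 0 := by
    rw [← Finset.sum_sub_distrib]
    refine Finset.sum_congr rfl fun k _ => ?_
    split_ifs <;> simp
  rw [h1, h2, h3, h4, h5, h6]
  abel

end Cubic

/-! ### Brackets of the quartic parts with the cubic and quadratic parts, and of the cubic parts. -/

section Hamiltonians

variable {I J S A : Type*} [Fintype I] [DecidableEq I] [DecidableEq J] [Fintype S] [DecidableEq S]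
  [Ring A] [Algebra ℂ A] (ω : WeightSystem J) (π : I → J) (node : S → I) (X : S → S → A)
  (t : I → ℂ)

/-- The weight of a pair of nodes in the quadratic part of the Hamiltonians. -/
def pairWeight (i l : I) : ℂ := ω.slope (π i) (π l) * t i - t l

/-- The quartic part of the Hamiltonian attached to the node `i`. -/
def quarticPart (i : I) : A := ∑ m, timeWeight π t i m • casimir ω π node X i m

/-- The cubic part of the Hamiltonian attached to the node `i`. -/
def cubicPart (i : I) : A := weightedTrace node (Pi.single i 1) (cubicMatrix ω (π ∘ node) X)

/-- The quadratic part of the Hamiltonian attached to the node `i`. -/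
def quadraticPart (i : I) : A :=
  ∑ e, ∑ f, (nodeIndicator node i e * pairWeight ω π t i (node f)) • (X e f * X f e)

variable {ω π node X t}

theorem IsWeylMatrix.isNodeCovariant_cubicMatrix (h : IsWeylMatrix ω (π ∘ node) X) {i m : I}
    (him : π i = π m) : IsNodeCovariant ω π node X i m (cubicMatrix ω (π ∘ node) X) := by
  have hX := h.isNodeCovariant him
  have := hX.mul (d := fun _ => 1) rfl
    ((hX.schur him fun x y => ω.gap y x).mul (d := fun _ => 1) rfl hX)
  simp only [one_smul, smul_mul_assoc, Finset.mul_sum, mul_smul_comm, ← mul_assoc] at this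
  exact this

theorem quarticPart_bracket_weightedTrace {i : I} {Z : S → S → A}
    (hZ : ∀ m, π m = π i → IsNodeCovariant ω π node X i m Z) (d : I → ℂ) :
    ⁅quarticPart ω π node X t i, weightedTrace node d Z⁆ =
      ∑ m, (timeWeight π t i m * (d i - d m)) • momentBracket ω π node X Z i m := by
  rw [quarticPart, sum_bracket]
  refine Finset.sum_congr rfl fun m _ => ?_
  rw [smul_bracket]
  by_cases hm : π m = π i
  · rw [(hZ m hm).casimir_bracket, smul_smul]
  · simp [timeWeight_of_ne t hm]

theorem quarticPart_bracket_nodeTrace {i j : I} (hij : i ≠ j) {Z : S → S → A}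
    (hZ : ∀ m, π m = π i → IsNodeCovariant ω π node X i m Z) :
    ⁅quarticPart ω π node X t i, weightedTrace node (Pi.single j 1) Z⁆ =
      -(timeWeight π t i j • momentBracket ω π node X Z i j) := by
  rw [quarticPart_bracket_weightedTrace hZ, Finset.sum_eq_single j]
  · simp [hij]
  · intro m _ hm
    simp [hij, hm]
  · simp

/-- `timeWeight` and `momentBracket` both alternate in i and j, so their product is symmetric and
the two brackets cancel. -/
theorem IsWeylMatrix.quartic_bracket_cubic (h : IsWeylMatrix ω (π ∘ node) X) {i j : I}
    (hij : i ≠ j) :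
    ⁅quarticPart ω π node X t i, cubicPart ω π node X j⁆ +
      ⁅cubicPart ω π node X i, quarticPart ω π node X t j⁆ = 0 := by
  rw [bracket_swap (cubicPart ω π node X i), cubicPart, cubicPart,
    quarticPart_bracket_nodeTrace hij fun m hm => h.isNodeCovariant_cubicMatrix hm.symm,
    quarticPart_bracket_nodeTrace hij.symm fun m hm => h.isNodeCovariant_cubicMatrix hm.symm]
  by_cases hp : π i = π j
  · rw [timeWeight_swap t i j, (h.isNodeCovariant_cubicMatrix hp).momentBracket_swap]
    simp
  · simp [timeWeight_of_ne t hp, timeWeight_of_ne t (Ne.symm hp)]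

/-- Setting the weight to 0 on the part of i is free, as X vanishes there. The weight then agrees at
all nodes of that part, as covariance of the product requires. -/
theorem IsWeylMatrix.quadraticPart_eq (h : IsWeylMatrix ω (π ∘ node) X) (i : I) :
    quadraticPart ω π node X t i = weightedTrace node (Pi.single i 1) fun a b =>
      ∑ l, (if π (node l) = π i then 0 else pairWeight ω π t i (node l)) • (X a l * X l b) := by
  rw [quadraticPart, weightedTrace]
  refine Finset.sum_congr rfl fun e _ => ?_
  simp only [mul_smul, ← Finset.smul_sum]
  refine nodeIndicator_smul_congr fun he => Finset.sum_congr rfl fun l _ => ?_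
  split_ifs with hl
  · rw [h.eq_zero (by simp [he, hl])]; simp
  · rfl

/-- Reversing each product makes j the inner node, and the pair weights become the outer weights of
a trace; commutators contribute the scalar. -/
theorem IsWeylMatrix.quadraticPart_eq_add_smul_one (h : IsWeylMatrix ω (π ∘ node) X) (j : I) :
    ∃ s : ℂ, quadraticPart ω π node X t j = weightedTrace node (pairWeight ω π t j) (fun a b =>
      ∑ c, (Pi.single j 1 : I → ℂ) (node c) • (X a c * X c b)) + s • 1 := by
  refine ⟨∑ e, ∑ f, (nodeIndicator node j e * pairWeight ω π t j (node f)) *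
    -(ω.gap (π (node e)) (π (node f)))⁻¹, ?_⟩
  rw [quadraticPart, weightedTrace, Finset.sum_smul]
  simp only [Finset.smul_sum, Finset.sum_smul]
  rw [Finset.sum_comm (f := fun a c => pairWeight ω π t j (node a) •
    (Pi.single j 1 : I → ℂ) (node c) • (X a c * X c a))]
  simp only [← Finset.sum_add_distrib]
  refine Finset.sum_congr rfl fun e _ => Finset.sum_congr rfl fun f _ => ?_
  rw [mul_eq_mul_add_bracket (X e f), h.lie, if_pos rfl, if_pos rfl, nodeIndicator]
  simp only [Function.comp_apply]
  module

/-- The weights at i and j differ by (t_i - t_j) times the slope of the common part, and this factor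
cancels the pole. -/
theorem IsWeylMatrix.quartic_bracket_quadratic_of_eq (h : IsWeylMatrix ω (π ∘ node) X)
    (ht : t ∈ timeSpace π) {i j : I} (hij : i ≠ j) (hp : π i = π j) :
    ⁅quarticPart ω π node X t i, quadraticPart ω π node X t j⁆ +
      ⁅quadraticPart ω π node X t i, quarticPart ω π node X t j⁆ =
    momentBracket ω π node X (fun a b =>
      ∑ l, ω.slope (π i) (π (node l)) • (X a l * X l b)) i j := by
  have hcov : ∀ k m m' : I, π m = π k → π m' = π k → IsNodeCovariant ω π node X m m' fun a b =>
      ∑ l, (if π (node l) = π k then 0 else pairWeight ω π t k (node l)) • (X a l * X l b) :=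
    fun k m m' hm hm' => (h.isNodeCovariant (hm.trans hm'.symm)).mul
      (d := fun x => if π x = π k then 0 else pairWeight ω π t k x) (by simp [hm, hm'])
      (h.isNodeCovariant (hm.trans hm'.symm))
  rw [bracket_swap (quadraticPart ω π node X t i), h.quadraticPart_eq, h.quadraticPart_eq,
    quarticPart_bracket_nodeTrace hij fun m hm => hcov j i m hp (hm.trans hp),
    quarticPart_bracket_nodeTrace hij.symm fun m hm => hcov i j m hp.symm (hm.trans hp.symm),
    timeWeight_swap t j i, (hcov i j i hp.symm rfl).momentBracket_swap]
  have hlin : (momentBracket ω π node X (fun a b => ∑ l, (if π (node l) = π i then 0 else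
      pairWeight ω π t i (node l)) • (X a l * X l b)) i j) -
      (momentBracket ω π node X (fun a b => ∑ l, (if π (node l) = π j then 0 else
      pairWeight ω π t j (node l)) • (X a l * X l b)) i j) =
      (t i - t j) • momentBracket ω π node X (fun a b =>
      ∑ l, ω.slope (π i) (π (node l)) • (X a l * X l b)) i j := by
    have hentry : ∀ a b, π (node a) = π i → (∑ l, (if π (node l) = π i then 0 else
        pairWeight ω π t i (node l)) • (X a l * X l b)) = (∑ l, (if π (node l) = π j then 0 else
        pairWeight ω π t j (node l)) • (X a l * X l b)) + (t i - t j) •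
        ∑ l, ω.slope (π i) (π (node l)) • (X a l * X l b) := by
      intro a b ha
      rw [Finset.smul_sum, ← Finset.sum_add_distrib]
      refine Finset.sum_congr rfl fun l _ => ?_
      rw [← hp]
      split_ifs with hl
      · rw [h.eq_zero (by simp [ha, hl])]; simp
      · rw [pairWeight, pairWeight, ← hp]; module
    simp only [momentBracket, Finset.smul_sum, ← Finset.sum_sub_distrib,
      smul_comm (t i - t j) (_ : ℂ) (_ : A)]
    simp only [← smul_sub]
    refine sum_nodeIndicator_congr fun e f he hf => ?_
    rw [hentry f e (by rw [hf, hp]), hentry e f (by rw [he])]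
    simp only [mul_add, add_mul, mul_smul_comm, smul_mul_assoc]
    rw [smul_sub]
    abel
  have hr : timeWeight π t i j * (t i - t j) = 1 := by
    rw [timeWeight, if_pos ⟨hp.symm, hij.symm⟩, inv_mul_cancel₀ (sub_ne_zero.2 (ht i j hij hp))]
  rw [← one_smul ℂ (momentBracket ω π node X (fun a b =>
      ∑ l, ω.slope (π i) (π (node l)) • (X a l * X l b)) i j), ← hr, mul_smul, ← hlin]
  module

theorem nodeTrace_bracket_nodeTrace (i j : I) (Z Z' : S → S → A) :
    ⁅weightedTrace node (Pi.single i 1) Z, weightedTrace node (Pi.single j 1) Z'⁆ =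
      ∑ e, ∑ f, (nodeIndicator node i e * nodeIndicator node j f) • ⁅Z e e, Z' f f⁆ := by
  rw [weightedTrace, sum_bracket]
  refine Finset.sum_congr rfl fun e _ => ?_
  rw [weightedTrace, bracket_sum]
  refine Finset.sum_congr rfl fun f _ => ?_
  rw [smul_bracket, bracket_smul, smul_smul, nodeIndicator, nodeIndicator]

theorem IsWeylMatrix.cubic_bracket_cubic_node_of_eq (h : IsWeylMatrix ω (π ∘ node) X)
    {i j : I} (hij : i ≠ j) (hp : π i = π j) :
    ⁅cubicPart ω π node X i, cubicPart ω π node X j⁆ =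
    -momentBracket ω π node X (fun a b =>
      ∑ l, ω.slope (π i) (π (node l)) • (X a l * X l b)) i j := by
  rw [cubicPart, cubicPart, nodeTrace_bracket_nodeTrace]
  simp only [momentBracket, ← Finset.sum_neg_distrib, ← smul_neg]
  refine sum_nodeIndicator_congr fun e f he hf => ?_
  rw [h.cubic_bracket_cubic_of_eq (fun hef => hij (by rw [← he, ← hf, hef]))
    (by simp [he, hf, hp])]
  simp only [Function.comp_apply, he]

variable (ω π node X) in
/-- The bracket of a quartic and a quadratic part attached to nodes in different parts. -/
def crossTerm (i j : I) : A :=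
  ∑ e, ∑ f, (nodeIndicator node i e * nodeIndicator node j f) •
    ∑ k, if (π ∘ node) k = (π ∘ node) e then
      momentMatrix ω (π ∘ node) X e k * (X k f * X f e) -
        X e f * X f k * momentMatrix ω (π ∘ node) X k e else 0

theorem IsWeylMatrix.cubic_bracket_cubic_node_of_ne (h : IsWeylMatrix ω (π ∘ node) X)
    {i j : I} (hp : π i ≠ π j) :
    ⁅cubicPart ω π node X i, cubicPart ω π node X j⁆ =
      crossTerm ω π node X i j - crossTerm ω π node X j i := by
  have hswap : crossTerm ω π node X j i =
    ∑ e, ∑ f, (nodeIndicator node i e * nodeIndicator node j f) •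
    ∑ k, if (π ∘ node) k = (π ∘ node) f then
      momentMatrix ω (π ∘ node) X f k * (X k e * X e f) -
        X f e * X e k * momentMatrix ω (π ∘ node) X k f else 0 := by
    rw [crossTerm, Finset.sum_comm]
    simp only [mul_comm (nodeIndicator node j _)]
  rw [hswap]
  rw [cubicPart, cubicPart, nodeTrace_bracket_nodeTrace]
  simp only [crossTerm, ← Finset.sum_sub_distrib, ← smul_sub]
  refine sum_nodeIndicator_congr fun e f he hf => ?_
  rw [h.cubic_bracket_cubic_of_ne (by simpa [he, hf] using hp), ← Finset.sum_sub_distrib]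

/-- For m in the part of i the slopes agree, so the weights at i and m differ by -(t_i - t_m),
cancelling the pole. The term m = i may be added because `momentBracket` vanishes on the diagonal,
which completes the sum over the part. -/
theorem IsWeylMatrix.quartic_bracket_quadratic_of_ne (h : IsWeylMatrix ω (π ∘ node) X)
    (ht : t ∈ timeSpace π) {i j : I} (hp : π i ≠ π j) :
    ⁅quarticPart ω π node X t i, quadraticPart ω π node X t j⁆ = -crossTerm ω π node X i j := by
  obtain ⟨s, hs⟩ := h.quadraticPart_eq_add_smul_one (t := t) j
  have hcov : ∀ m, π m = π i → IsNodeCovariant ω π node X i m fun a b =>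
      ∑ c, (Pi.single j 1 : I → ℂ) (node c) • (X a c * X c b) := fun m hm =>
    (h.isNodeCovariant hm.symm).mul (by
      rw [Pi.single_eq_of_ne (fun e => hp (congrArg π e)),
        Pi.single_eq_of_ne (fun e => hp (hm.symm.trans (congrArg π e)))]) (h.isNodeCovariant hm.symm)
  rw [hs, bracket_add, bracket_smul, bracket_one, smul_zero, add_zero,
    quarticPart_bracket_weightedTrace hcov]
  have hterm : ∀ m, (timeWeight π t i m * (pairWeight ω π t j i - pairWeight ω π t j m)) •
      momentBracket ω π node X (fun a b =>
        ∑ c, (Pi.single j 1 : I → ℂ) (node c) • (X a c * X c b)) i m =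
      -if π m = π i then momentBracket ω π node X (fun a b =>
        ∑ c, (Pi.single j 1 : I → ℂ) (node c) • (X a c * X c b)) i m else 0 := by
    intro m
    split_ifs with hm
    · by_cases hmi : m = i
      · subst hmi
        rw [(hcov m rfl).momentBracket_self]; simp
      · rw [timeWeight, if_pos ⟨hm, hmi⟩, pairWeight, pairWeight, hm]
        have h2 := sub_ne_zero.2 (ht i m (Ne.symm hmi) hm.symm)
        have : (t i - t m)⁻¹ * (ω.slope (π j) (π i) * t j - t i -
            (ω.slope (π j) (π i) * t j - t m)) = -1 := by
          field_simp; ring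
        rw [this, neg_one_smul]
    · rw [timeWeight_of_ne t hm]; simp
  simp only [hterm, Finset.sum_neg_distrib]
  congr 1
  set Y : S → S → A := fun a b => ∑ c, (Pi.single j 1 : I → ℂ) (node c) • (X a c * X c b) with hY
  have hnodes : (∑ m, if π m = π i then momentBracket ω π node X Y i m else 0) =
      ∑ e, ∑ k, nodeIndicator node i e • if π (node k) = π i then
        momentMatrix ω (π ∘ node) X e k * Y k e - Y e k * momentMatrix ω (π ∘ node) X k e
        else 0 := by
    have hpush : ∀ m, (if π m = π i then momentBracket ω π node X Y i m else 0) =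
        ∑ e, ∑ k, if π m = π i then (nodeIndicator node i e * nodeIndicator node m k) •
          (momentMatrix ω (π ∘ node) X e k * Y k e - Y e k * momentMatrix ω (π ∘ node) X k e)
        else 0 := fun m => by
      split_ifs
      · rfl
      · simp
    simp only [hpush]
    rw [Finset.sum_comm]
    refine Finset.sum_congr rfl fun e _ => ?_
    rw [Finset.sum_comm]
    refine Finset.sum_congr rfl fun k _ => ?_
    rw [Finset.sum_eq_single (node k)]
    · simp [nodeIndicator]
    · intro m _ hm
      simp [nodeIndicator, hm.symm]
    · simp
  rw [hnodes, crossTerm]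
  refine Finset.sum_congr rfl fun e _ => ?_
  simp only [mul_smul, ← Finset.smul_sum]
  refine nodeIndicator_smul_congr fun he => ?_
  simp only [Finset.smul_sum]
  rw [Finset.sum_comm]
  refine Finset.sum_congr rfl fun k _ => ?_
  simp only [Function.comp_apply, he]
  split_ifs with hk
  · rw [hY]
    simp only [Finset.mul_sum, Finset.sum_mul, ← Finset.sum_sub_distrib, mul_smul_comm,
      smul_mul_assoc, ← smul_sub, nodeIndicator]
  · simp

end Hamiltonians

/-! ### The adjoint action of the quadratic parts, and commutation of the Hamiltonians. -/

section Quadratic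

variable {I J S A : Type*} [Fintype I] [DecidableEq I] [DecidableEq J] [Fintype S] [DecidableEq S]
  [Ring A] [Algebra ℂ A] (ω : WeightSystem J) (π : I → J) (node : S → I) (X : S → S → A)
  (t : I → ℂ)

/-- The eigenvalue of the adjoint action of the quadratic part at `i` on the entry `X k l`. -/
def scaling (i : I) (k l : S) : ℂ :=
  (nodeIndicator node i k * pairWeight ω π t i (node l) +
    nodeIndicator node i l * pairWeight ω π t i (node k)) * (ω.gap (π (node k)) (π (node l)))⁻¹

variable {ω π node X t}

theorem scaling_swap (i : I) (k l : S) :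
    scaling ω π node t i l k = -scaling ω π node t i k l := by
  rw [scaling, scaling, ω.gap_swap, inv_neg]
  ring

theorem IsWeylMatrix.quadratic_bracket (h : IsWeylMatrix ω (π ∘ node) X) (i : I) (k l : S) :
    ⁅quadraticPart ω π node X t i, X k l⁆ = scaling ω π node t i k l • X k l := by
  simp only [quadraticPart, sum_bracket, smul_bracket, mul_bracket, h.lie, smul_add, mul_smul_comm,
    mul_one, smul_mul_assoc, one_mul, smul_smul, Finset.sum_add_distrib, mul_ite, mul_zero,
    ite_smul, ite_mul, zero_mul, smul_ite, smul_zero, zero_smul, Finset.sum_ite_irrel,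
    Finset.sum_ite_eq', Finset.sum_ite_eq, Finset.mem_univ, if_true, Finset.sum_const_zero]
  rw [← add_smul, scaling, Function.comp_apply, Function.comp_apply,
    ω.gap_swap (π (node l)) (π (node k)), inv_neg]
  congr 1
  ring

/-- Transposed entries have opposite eigenvalues, so each product X e f * X f e is fixed. -/
theorem IsWeylMatrix.quadratic_bracket_quadratic (h : IsWeylMatrix ω (π ∘ node) X) (i j : I) :
    ⁅quadraticPart ω π node X t i, quadraticPart ω π node X t j⁆ = 0 := by
  conv_lhs => rw [quadraticPart.eq_def ω π node X t j]
  simp only [bracket_sum, bracket_smul]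
  refine Finset.sum_eq_zero fun e _ => Finset.sum_eq_zero fun f _ => ?_
  rw [bracket_mul, h.quadratic_bracket, h.quadratic_bracket, scaling_swap, smul_mul_assoc,
    mul_smul_comm, ← add_smul, neg_add_cancel, zero_smul, smul_zero]

theorem sum_rotate {S A : Type*} [Fintype S] [AddCommMonoid A] (F : S → S → S → A) :
    ∑ f, ∑ l, ∑ k, F f l k = ∑ f, ∑ l, ∑ k, F l k f := by
  rw [Finset.sum_congr rfl fun f _ => Finset.sum_comm, Finset.sum_comm]

theorem IsWeylMatrix.cubic_rotate (h : IsWeylMatrix ω (π ∘ node) X) (f l k : S) :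
    X f l * X l k * X k f = X l k * X k f * X f l := by
  by_cases hf : f = k
  · rw [h.eq_zero (e := k) (f := f) (by rw [hf])]; simp
  by_cases hl : l = k
  · rw [h.eq_zero (e := l) (f := k) (by rw [hl])]; simp
  rw [h.entry_mul_comm (e := f) (f := l) fun h1 _ => absurd h1 hf, mul_assoc,
    h.entry_mul_comm (e := f) (f := l) fun _ h1 => absurd h1 hl, mul_assoc]

/-- The sum of the cubic monomials passing through the nodes `j` and `i` in this order. -/
def cubicPair (ω : WeightSystem J) (π : I → J) (node : S → I) (X : S → S → A) (t : I → ℂ)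
    (i j : I) : A :=
  ∑ f, ∑ l, ∑ k, (nodeIndicator node j f * nodeIndicator node i l *
    (ω.gap (π (node k)) (π (node l)) * (pairWeight ω π t i (node f) *
      (ω.gap (π (node f)) (π (node l)))⁻¹ + pairWeight ω π t i (node k) *
      (ω.gap (π (node l)) (π (node k)))⁻¹))) • (X f l * X l k * X k f)

/-- In a cubic monomial starting over j, the node i may occupy either of the other two places,
giving two sums. The second is the first with i and j exchanged, after a rotation. Symmetry in i and
j is what cancels the [3,2] terms. -/
theorem IsWeylMatrix.quadratic_bracket_cubic (h : IsWeylMatrix ω (π ∘ node) X) {i j : I}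
    (hij : i ≠ j) : ⁅quadraticPart ω π node X t i, cubicPart ω π node X j⁆ =
      cubicPair ω π node X t i j + cubicPair ω π node X t j i := by
  have hij' : cubicPair ω π node X t j i = ∑ f, ∑ l, ∑ k,
    (nodeIndicator node j f * nodeIndicator node i k *
    (ω.gap (π (node k)) (π (node l)) * (pairWeight ω π t i (node l) *
      (ω.gap (π (node l)) (π (node k)))⁻¹ + pairWeight ω π t i (node f) *
      (ω.gap (π (node k)) (π (node f)))⁻¹))) • (X f l * X l k * X k f) := by
    rw [cubicPair, sum_rotate, sum_rotate]
    refine Finset.sum_congr rfl fun f _ => Finset.sum_congr rfl fun l _ =>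
      Finset.sum_congr rfl fun k _ => ?_
    rw [h.cubic_rotate k f l, mul_comm (nodeIndicator node i k)]
    simp only [mul_assoc (nodeIndicator node j f), mul_smul (nodeIndicator node _ _)]
    refine nodeIndicator_smul_congr fun hf => nodeIndicator_smul_congr fun hk => ?_
    subst hf hk
    by_cases h1 : π (node f) = π (node l)
    · rw [h.eq_zero h1]; simp
    by_cases h2 : π (node l) = π (node k)
    · rw [h.eq_zero h2]; simp
    by_cases h3 : π (node k) = π (node f)
    · rw [h.eq_zero h3]; simp
    have g1 := ω.gap_ne_zero h1
    have g2 := ω.gap_ne_zero h2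
    have g3 := ω.gap_ne_zero h3
    have e1 := ω.gap_eq h3 (Ne.symm h1)
    have e2 := ω.gap_eq h2 (Ne.symm h3)
    congr 1
    rw [ω.gap_swap (π (node l)) (π (node f)), ω.gap_swap (π (node k)) (π (node l))]
    rw [ω.gap_swap (π (node k)) (π (node l)), ω.gap_swap (π (node f)) (π (node k))] at e1
    rw [ω.gap_swap (π (node l)) (π (node f)), ω.gap_swap (π (node k)) (π (node l))] at e2
    simp only [pairWeight]
    field_simp
    -- The coefficients of the times at f and k need `gap_eq` based at their parts; that of the time
    -- at l matches by itself.
    linear_combination t (node f) * e1 - t (node k) * e2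
  rw [hij', cubicPair]
  simp only [← Finset.sum_add_distrib]
  rw [cubicPart, weightedTrace, bracket_sum]
  refine Finset.sum_congr rfl fun f _ => ?_
  rw [bracket_smul, cubicMatrix, bracket_sum, Finset.smul_sum]
  refine Finset.sum_congr rfl fun l _ => ?_
  rw [bracket_sum, Finset.smul_sum]
  refine Finset.sum_congr rfl fun k _ => ?_
  rw [bracket_smul, bracket_mul, bracket_mul, h.quadratic_bracket, h.quadratic_bracket,
    h.quadratic_bracket]
  simp only [smul_mul_assoc, mul_smul_comm, ← add_smul, smul_smul, ← mul_add]
  have hf : nodeIndicator node j f * nodeIndicator node i f = 0 := by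
    by_cases hf : node f = j <;> simp [nodeIndicator, Pi.single_apply, hf, hij.symm]
  congr 1
  simp only [scaling, Function.comp_apply]
  change nodeIndicator node j f * _ = _
  linear_combination (ω.gap (π (node k)) (π (node l)) * (pairWeight ω π t i (node l) *
    (ω.gap (π (node f)) (π (node l)))⁻¹ + pairWeight ω π t i (node k) *
    (ω.gap (π (node k)) (π (node f)))⁻¹)) * hf

/-- The Hamiltonian attached to the node `i`, up to scalars. -/
def hamiltonian (ω : WeightSystem J) (π : I → J) (node : S → I) (X : S → S → A) (t : I → ℂ)
    (i : I) : A :=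
  quarticPart ω π node X t i + cubicPart ω π node X i + quadraticPart ω π node X t i

theorem IsWeylMatrix.hamiltonian_bracket_hamiltonian (h : IsWeylMatrix ω (π ∘ node) X)
    (ht : t ∈ timeSpace π) (i j : I) :
    ⁅hamiltonian ω π node X t i, hamiltonian ω π node X t j⁆ = 0 := by
  by_cases hij : i = j
  · rw [hij, bracket_self]
  have h43 := h.quartic_bracket_cubic (t := t) hij
  have h32 : ⁅cubicPart ω π node X i, quadraticPart ω π node X t j⁆ +
      ⁅quadraticPart ω π node X t i, cubicPart ω π node X j⁆ = 0 := by
    rw [bracket_swap (cubicPart ω π node X i), h.quadratic_bracket_cubic hij,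
      h.quadratic_bracket_cubic (Ne.symm hij)]
    abel
  have h42 : ⁅quarticPart ω π node X t i, quadraticPart ω π node X t j⁆ +
      ⁅quadraticPart ω π node X t i, quarticPart ω π node X t j⁆ +
      ⁅cubicPart ω π node X i, cubicPart ω π node X j⁆ = 0 := by
    by_cases hp : π i = π j
    · rw [h.quartic_bracket_quadratic_of_eq ht hij hp, h.cubic_bracket_cubic_node_of_eq hij hp,
        add_neg_cancel]
    · rw [bracket_swap (quadraticPart ω π node X t i), h.quartic_bracket_quadratic_of_ne ht hp,
        h.quartic_bracket_quadratic_of_ne ht (Ne.symm hp), h.cubic_bracket_cubic_node_of_ne hp]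
      abel
  have h44 : ⁅quarticPart ω π node X t i, quarticPart ω π node X t j⁆ = 0 :=
    h.quartic_bracket_quartic ht hij
  have h22 := h.quadratic_bracket_quadratic (t := t) i j
  simp only [hamiltonian, add_bracket, bracket_add]
  calc _ = ⁅quarticPart ω π node X t i, quarticPart ω π node X t j⁆ +
        (⁅quarticPart ω π node X t i, cubicPart ω π node X j⁆ +
          ⁅cubicPart ω π node X i, quarticPart ω π node X t j⁆) +
        (⁅quarticPart ω π node X t i, quadraticPart ω π node X t j⁆ +
          ⁅quadraticPart ω π node X t i, quarticPart ω π node X t j⁆ +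
          ⁅cubicPart ω π node X i, cubicPart ω π node X j⁆) +
        (⁅cubicPart ω π node X i, quadraticPart ω π node X t j⁆ +
          ⁅quadraticPart ω π node X t i, cubicPart ω π node X j⁆) +
        ⁅quadraticPart ω π node X t i, quadraticPart ω π node X t j⁆ := by abel
    _ = 0 := by rw [h44, h43, h42, h32, h22]; simp

end Quadratic

/-! ### Commutation relations of the quantised matrix entries. -/

theorem WeylAlgebra.ι_bracket_ι {M : Type*} [AddCommGroup M] [Module ℂ M]
    (ω : LinearMap.BilinForm ℂ M) (x y : M) :
    ⁅WeylAlgebra.ι ω x, WeylAlgebra.ι ω y⁆ = ω x y • (1 : WeylAlgebra ω) := by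
  have := RingQuot.mkAlgHom_rel ℂ (WeylRel.of (ω := ω) x y)
  rw [map_sub, map_mul, map_mul, AlgHom.commutes, Algebra.algebraMap_eq_smul_one] at this
  exact this

theorem linearQuantisation_bracket {M : Type*} [AddCommGroup M] [Module ℂ M]
    [FiniteDimensional ℂ M] (ω : LinearMap.BilinForm ℂ M) (hω : ω.Nondegenerate)
    (f g : Module.Dual ℂ M) (y : M) (hy : ω y = g) :
    ⁅linearQuantisation ω hω f, linearQuantisation ω hω g⁆ = f y • (1 : WeylAlgebra ω) := by
  have hg : (LinearMap.BilinForm.toDual ω hω).symm g = y := by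
    rw [LinearEquiv.symm_apply_eq, ← hy]; rfl
  have hf := LinearMap.BilinForm.apply_toDual_symm_apply (hB := hω) f y
  rw [linearQuantisation, LinearMap.comp_apply, LinearMap.comp_apply]
  simp only [LinearEquiv.coe_coe]
  rw [WeylAlgebra.ι_bracket_ι, hg, hf]

section Entries

variable {J I : Type*} [Fintype J] [Fintype I] (π : I → J) {a : J → OnePoint ℂ}
  (ha : Function.Injective a)
  {V : I → Type*} [∀ i, AddCommGroup (V i)] [∀ i, Module ℂ (V i)]
  [∀ i, FiniteDimensional ℂ (V i)]
  {N : I → Type*} [∀ i, Fintype (N i)] (b : ∀ i, Module.Basis (N i) ℂ (V i))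

/-- The `(v, k)` coordinate on the space `W^j`, which vanishes if `v` is not in the part `j`. -/
def partCoord {v : I} (k : N v) (j : J) : Module.Dual ℂ (PartSpace π V j) := by
  classical
  exact if h : π v = j then (b v).coord k ∘ₗ LinearMap.proj (⟨v, h⟩ : {i : I // π i = j}) else 0

/-- The basis vector of index `(u, l)` in `W^j`, which vanishes if `u` is not in the part `j`. -/
def partVector {u : I} (l : N u) (j : J) : PartSpace π V j := by
  classical
  exact fun i => if h : u = i.1 then h ▸ b u l else 0

/-- The point of `𝕄` corresponding to the linear function `coordX` by the symplectic form. -/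
def dualPoint {u v : I} (k : N v) (l : N u) : RepSpace π V :=
  fun p => -(partCoord π b k p.1.1).smulRight (partVector π b l p.1.2)

theorem partCoord_of_ne {v : I} (k : N v) {j : J} (h : π v ≠ j) : partCoord π b k j = 0 := by
  simp [partCoord, h]

theorem partVector_of_ne {u : I} (l : N u) {j : J} (h : π u ≠ j) : partVector π b l j = 0 := by
  funext i
  have : u ≠ i.1 := fun e => h (e ▸ i.2)
  simp [partVector, this]

open Classical in
theorem partVector_self {u : I} (l : N u) : partVector π b l (π u) =
    (Pi.single (⟨u, rfl⟩ : {i : I // π i = π u}) (b u l) : PartSpace π V (π u)) := by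
  funext ⟨i, hi⟩
  by_cases h : u = i
  · subst h
    simp [partVector]
  · rw [Pi.single_eq_of_ne (by simpa using Ne.symm h)]
    simp [partVector, h]

open Classical in
theorem coordX_apply {u v : I} (h : π u ≠ π v) (k : N v) (l : N u) (w : RepSpace π V) :
    coordX (a := a) π b h k l w = phi a (π v) (π u) *
      partCoord π b k (π v) (w ⟨(π u, π v), h⟩ (partVector π b l (π u))) := by
  rw [partVector_self]
  simp [coordX, partCoord, blockX, blockB, opp]

-- The form pairs opposite blocks by the trace, and composing with a rank one map turns the trace
-- into a matrix entry.
open Classical in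
theorem omega_dualPoint {u v : I} (h : π u ≠ π v) (k : N v) (l : N u) :
    omega π a V (dualPoint π b k l) = coordX (a := a) π b h k l := by
  refine LinearMap.ext fun w => ?_
  rw [omega_eq_sum, coordX_apply, Finset.sum_eq_single ⟨(π u, π v), h⟩]
  · simp only [dualPoint, opp, LinearMap.neg_comp, map_neg]
    rw [LinearMap.trace_comp_comm']
    have : w ⟨(π u, π v), h⟩ ∘ₗ (partCoord π b k (π v)).smulRight (partVector π b l (π u)) =
        (partCoord π b k (π v)).smulRight (w ⟨(π u, π v), h⟩ (partVector π b l (π u))) :=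
      LinearMap.ext fun x => by simp
    rw [this, LinearMap.trace_smulRight, phi, phi, gap_swap (a (π u)), inv_neg]
    ring
  · rintro ⟨⟨x, y⟩, hxy⟩ _ hne
    have : dualPoint π b k l (opp ⟨(x, y), hxy⟩) = 0 := by
      by_cases hx : π u = x
      · have hy : π v ≠ y := fun hy => hne (by simp [hx, hy])
        simp [dualPoint, opp, partCoord_of_ne π b k hy]
      · refine LinearMap.ext fun z => ?_
        simp [dualPoint, opp, partVector_of_ne π b l hx]
    rw [this]; simp
  · simp

open Classical in
theorem partCoord_partVector {u v : I} (k : N v) (l : N u) (j : J) (hv : π v = j) :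
    partCoord π b k j (partVector π b l j) =
      if (⟨v, k⟩ : Σ i, N i) = ⟨u, l⟩ then 1 else 0 := by
  by_cases h : u = v
  · subst h
    simp [partCoord, partVector, hv, Finsupp.single_apply, eq_comm]
  · have : ¬ ((⟨v, k⟩ : Σ i, N i) = ⟨u, l⟩) := fun e => h (congrArg Sigma.fst e).symm
    simp [partCoord, partVector, hv, h, this]

open Classical in
theorem partCoord_partVector_of_tail {u v : I} (k : N v) (l : N u) (j : J) (hu : π u = j) :
    partCoord π b k j (partVector π b l j) =
      if (⟨v, k⟩ : Σ i, N i) = ⟨u, l⟩ then 1 else 0 := by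
  by_cases hv : π v = j
  · exact partCoord_partVector π b k l j hv
  · rw [partCoord_of_ne π b k hv, if_neg, LinearMap.zero_apply]
    exact fun e => hv ((congrArg (fun x : Σ i, N i => π x.1) e).trans hu)

open Classical in
/-- The entries of the matrices `X̂^α`, as a matrix indexed by the union of the bases. -/
def entry (e f : Σ i, N i) : WeylAlgebra (omega π a V) :=
  if h : π f.1 ≠ π e.1 then arrowMatrix π ha b h e.2 f.2 else 0

theorem entry_eq_zero {e f : Σ i, N i} (h : π e.1 = π f.1) : entry π ha b e f = 0 := by
  rw [entry, dif_neg]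
  exact fun h' => h' h.symm

open Classical in
theorem isWeylMatrix_entry :
    IsWeylMatrix (WeightSystem.ofReading a ha) (π ∘ Sigma.fst) (entry π ha b) where
  eq_zero h := entry_eq_zero π ha b h
  lie := by
    rintro ⟨v, k⟩ ⟨u, l⟩ ⟨v', k'⟩ ⟨u', l'⟩
    by_cases h : π u = π v
    · rw [entry_eq_zero π ha b h.symm, zero_bracket]
      simp [h, WeightSystem.gap_self]
    by_cases h' : π u' = π v'
    · rw [entry_eq_zero π ha b (e := ⟨v', k'⟩) (f := ⟨u', l'⟩) h'.symm, bracket_zero]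
      split_ifs with h1 h2
      · refine absurd ?_ h
        have e1 := congrArg (fun x : Σ i, N i => π x.1) h1
        have e2 := congrArg (fun x : Σ i, N i => π x.1) h2
        exact e2.trans (h'.symm.trans e1.symm)
      · simp
      · simp
    rw [entry, entry, dif_pos h, dif_pos h', arrowMatrix, arrowMatrix, Matrix.of_apply,
      Matrix.of_apply, linearQuantisation_bracket _ _ _ _ _ (omega_dualPoint π b h' k' l'),
      coordX_apply]
    congr 1
    simp only [dualPoint, LinearMap.neg_apply, LinearMap.smulRight_apply, map_neg, map_smul,
      smul_eq_mul]
    rw [partCoord_partVector π b k l' _ rfl, partCoord_partVector_of_tail π b k' l _ rfl]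
    simp only [eq_comm (a := (⟨v', k'⟩ : Σ i, N i)), phi, WeightSystem.ofReading,
      Function.comp_apply]
    split_ifs <;> simp

end Entries

/-! ### The effect of the anchoring of quartic cycles. -/

section Anchoring

variable {J S A : Type*} [Fintype S] [DecidableEq S] [Ring A] [Algebra ℂ A]
  {ω : WeightSystem J} {p : S → J} {X : S → S → A}

/-- Moving the last factor X e x to the front, it can fail to commute only with X z e, and only for
x = z. -/
theorem IsWeylMatrix.quartic_anchor (h : IsWeylMatrix ω p X) {e f : S} (hef : e ≠ f)
    (hp : p e = p f) (x z : S) :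
    X x f * X f z * X z e * X e x = X e x * X x f * X f z * X z e +
      if x = z then (ω.gap (p e) (p x))⁻¹ • (X x f * X f x) else 0 := by
  have c1 := mul_eq_mul_add_bracket (X z e) (X e x)
  have c2 : X x f * X e x = X e x * X x f := h.entry_mul_comm fun _ hh => absurd hh.symm hef
  have c3 : X f z * X e x = X e x * X f z := h.entry_mul_comm fun _ hh => by rw [hh, hp]
  have c4 : X x f * X f z * ⁅X z e, X e x⁆ =
      if x = z then (ω.gap (p e) (p x))⁻¹ • (X x f * X f x) else 0 := by
    rw [h.lie]
    by_cases hxz : x = z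
    · subst hxz
      rw [if_pos rfl, if_pos rfl, if_pos rfl, ω.gap_swap, inv_neg, neg_neg, mul_smul_comm, mul_one]
    · simp [hxz, Ne.symm hxz]
  rw [mul_assoc (X x f * X f z), c1, mul_add, c4]
  congr 1
  calc _ = X x f * (X f z * X e x) * X z e := by noncomm_ring
    _ = (X x f * X e x) * X f z * X z e := by rw [c3]; noncomm_ring
    _ = _ := by rw [c2]

/-- The correction has weight gap² · gap⁻¹ = gap (also when the gap is 0), so it sums to R_ff up to
a scalar. -/
theorem IsWeylMatrix.sum_quartic (h : IsWeylMatrix ω p X) {e f : S} (hp : p e = p f) :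
    ∑ x, ∑ z, (ω.gap (p e) (p x) * ω.gap (p e) (p z)) • (X e x * X x f * X f z * X z e +
      if x = z then (ω.gap (p e) (p x))⁻¹ • (X x f * X f x) else 0) =
    momentMatrix ω p X e f * momentMatrix ω p X f e + momentMatrix ω p X f f +
      (∑ x, ω.gap (p f) (p x) * (ω.gap (p f) (p x))⁻¹) • 1 := by
  have h1 : ∀ x, X x f * X f x = X f x * X x f + (ω.gap (p f) (p x))⁻¹ • 1 := by
    intro x
    rw [mul_eq_mul_add_bracket, h.lie, if_pos rfl, if_pos rfl, ω.gap_swap, inv_neg, neg_neg]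
  simp only [smul_add, Finset.sum_add_distrib, smul_ite, smul_zero, Finset.sum_ite_eq,
    Finset.mem_univ, if_true, hp, h1, smul_smul, mul_assoc, mul_self_mul_inv]
  rw [add_assoc]
  congr 1
  · rw [momentMatrix, momentMatrix, Finset.sum_mul_sum]
    refine Finset.sum_congr rfl fun x _ => Finset.sum_congr rfl fun z _ => ?_
    rw [smul_mul_smul_comm, hp, mul_assoc]
  · have h2 : ∀ x, ω.gap (p f) (p x) * (ω.gap (p f) (p x) * (ω.gap (p f) (p x))⁻¹) =
        ω.gap (p f) (p x) := fun x => by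
      rw [← mul_assoc, mul_self_mul_inv]
    have h3 : ∀ x, ω.gap (p f) (p x) * (ω.gap (p f) (p x) * ((ω.gap (p f) (p x))⁻¹ *
        (ω.gap (p f) (p x))⁻¹)) = ω.gap (p f) (p x) * (ω.gap (p f) (p x))⁻¹ := fun x => by
      rw [← mul_assoc (ω.gap (p f) (p x)) (ω.gap (p f) (p x))⁻¹, ← mul_assoc, ← mul_assoc,
        mul_self_mul_inv]
    simp only [h2, h3, Finset.sum_add_distrib, momentMatrix, Finset.sum_smul]

end Anchoring

theorem add_smul_one_bracket_add_smul_one {A : Type*} [Ring A] [Algebra ℂ A] {x y : A}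
    (h : ⁅x, y⁆ = 0) (s s' : ℂ) : ⁅x + s • (1 : A), y + s' • (1 : A)⁆ = 0 := by
  rw [add_bracket, bracket_add, bracket_smul, bracket_one, smul_bracket, one_bracket, h]
  simp

theorem sum_subtype_of_eq_zero {I A : Type*} [Fintype I] [AddCommMonoid A] {P : I → Prop}
    [DecidablePred P] (G : I → A) (hG : ∀ j, ¬P j → G j = 0) :
    ∑ j : {j // P j}, G j = ∑ j, G j := by
  rw [← Fintype.sum_subtype_add_sum_subtype P G,
    Finset.sum_eq_zero (s := Finset.univ) (f := fun j : {j // ¬P j} => G j) fun j _ => hG j j.2,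
    add_zero]

theorem sum_nodeIndicator_fst {I A : Type*} [Fintype I] [DecidableEq I] {N : I → Type*}
    [∀ i, Fintype (N i)] [Ring A] [Algebra ℂ A] (i : I) (F : (Σ i, N i) → A) :
    ∑ e, nodeIndicator Sigma.fst i e • F e = ∑ k : N i, F ⟨i, k⟩ := by
  rw [Fintype.sum_sigma, Finset.sum_eq_single i]
  · simp [nodeIndicator]
  · intro j _ hj
    simp [nodeIndicator, hj]
  · simp

theorem sum_nodeIndicator_fst_mul {I A : Type*} [Fintype I] [DecidableEq I] {N : I → Type*}
    [∀ i, Fintype (N i)] [Ring A] [Algebra ℂ A] (i m : I) (F : (Σ i, N i) → (Σ i, N i) → A) :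
    ∑ e, ∑ f, (nodeIndicator Sigma.fst i e * nodeIndicator Sigma.fst m f) • F e f =
      ∑ k : N i, ∑ y : N m, F ⟨i, k⟩ ⟨m, y⟩ := by
  simp only [mul_smul, ← Finset.smul_sum, sum_nodeIndicator_fst]

theorem weightedTrace_fst {I A : Type*} [Fintype I] [DecidableEq I] {N : I → Type*}
    [∀ i, Fintype (N i)] [Ring A] [Algebra ℂ A] (i : I) (Z : (Σ i, N i) → (Σ i, N i) → A) :
    weightedTrace Sigma.fst (Pi.single i 1) Z = ∑ k : N i, Z ⟨i, k⟩ ⟨i, k⟩ :=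
  sum_nodeIndicator_fst i fun e => Z e e

theorem gap_self (x : OnePoint ℂ) : gap x x = 0 := by
  have := gap_swap x x
  linear_combination this / 2

/-! ### Quantum traces of the potentials in terms of the matrix of entries. -/

section Traces

variable {J I : Type*} [Fintype J] [Fintype I] (π : I → J) {a : J → OnePoint ℂ}
  (ha : Function.Injective a)
  {V : I → Type*} [∀ i, AddCommGroup (V i)] [∀ i, Module ℂ (V i)]
  [∀ i, FiniteDimensional ℂ (V i)]
  {N : I → Type*} [∀ i, Fintype (N i)] (b : ∀ i, Module.Basis (N i) ℂ (V i))

/-- `Tr(X̂_{ij} X̂_{ji})`. -/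
def traceTwo (i j : I) : WeylAlgebra (omega π a V) :=
  ∑ k : N i, ∑ x : N j, entry π ha b ⟨i, k⟩ ⟨j, x⟩ * entry π ha b ⟨j, x⟩ ⟨i, k⟩

/-- `Tr(X̂_{il} X̂_{lj} X̂_{ji})`. -/
def traceThree (i l j : I) : WeylAlgebra (omega π a V) :=
  ∑ k : N i, ∑ y : N l, ∑ x : N j,
    entry π ha b ⟨i, k⟩ ⟨l, y⟩ * entry π ha b ⟨l, y⟩ ⟨j, x⟩ * entry π ha b ⟨j, x⟩ ⟨i, k⟩

/-- `Tr(X̂_{ij} X̂_{jm} X̂_{ml} X̂_{li})`. -/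
def traceFour (i j m l : I) : WeylAlgebra (omega π a V) :=
  ∑ k : N i, ∑ x : N j, ∑ y : N m, ∑ z : N l,
    entry π ha b ⟨i, k⟩ ⟨j, x⟩ * entry π ha b ⟨j, x⟩ ⟨m, y⟩ * entry π ha b ⟨m, y⟩ ⟨l, z⟩ *
      entry π ha b ⟨l, z⟩ ⟨i, k⟩

theorem entry_of_ne {u v : I} (h : π u ≠ π v) (k : N v) (l : N u) :
    entry π ha b ⟨v, k⟩ ⟨u, l⟩ = arrowMatrix π ha b h k l := by
  rw [entry, dif_pos h]

theorem quantumTrace_single (c : AnchoredCycle π) :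
    quantumTrace π ha b (Finsupp.single c 1) = (walkMatrix π ha b c.2).trace := by
  simp [quantumTrace]

theorem quantumTrace_twoCycle (i j : I) (hij : π i ≠ π j) :
    quantumTrace π ha b (Finsupp.single (twoCycle π i j hij) 1) = traceTwo π ha b i j := by
  rw [quantumTrace_single, twoCycle]
  simp only [walkMatrix, Matrix.one_mul, Matrix.trace, Matrix.diag_apply, Matrix.mul_apply]
  simp only [traceTwo, entry_of_ne π ha b hij, entry_of_ne π ha b (Ne.symm hij)]

theorem quantumTrace_threeCycle (i j l : I) (hij : π i ≠ π j) (hjl : π j ≠ π l)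
    (hli : π l ≠ π i) :
    quantumTrace π ha b (Finsupp.single (threeCycle π i j l hij hjl hli) 1) =
      traceThree π ha b i l j := by
  rw [quantumTrace_single, threeCycle]
  simp only [walkMatrix, Matrix.one_mul, Matrix.trace, Matrix.diag_apply, Matrix.mul_apply, traceThree,
    entry_of_ne π ha b hij, entry_of_ne π ha b hjl, entry_of_ne π ha b hli, Finset.sum_mul]
  exact Finset.sum_congr rfl fun k _ => Finset.sum_comm

theorem quantumTrace_fourCycle (i l m j : I) (hil : π i ≠ π l) (hlm : π l ≠ π m)
    (hmj : π m ≠ π j) (hji : π j ≠ π i) :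
    quantumTrace π ha b (Finsupp.single (fourCycle π i l m j hil hlm hmj hji) 1) =
      traceFour π ha b i j m l := by
  rw [quantumTrace_single, fourCycle]
  simp only [walkMatrix, Matrix.one_mul, Matrix.trace, Matrix.diag_apply, Matrix.mul_apply, traceFour,
    entry_of_ne π ha b hil, entry_of_ne π ha b hlm, entry_of_ne π ha b hmj,
    entry_of_ne π ha b hji, Finset.sum_mul]
  refine Finset.sum_congr rfl fun k _ => ?_
  rw [Finset.sum_congr rfl fun z _ => Finset.sum_comm, Finset.sum_comm]
  exact Finset.sum_congr rfl fun x _ => Finset.sum_comm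

theorem traceTwo_of_eq {i j : I} (h : π i = π j) : traceTwo π ha b i j = 0 :=
  Finset.sum_eq_zero fun k _ => Finset.sum_eq_zero fun x _ => by
    rw [entry_eq_zero π ha b h, zero_mul]

theorem traceThree_of_eq {i l j : I} (h : ¬(π i ≠ π j ∧ π j ≠ π l ∧ π l ≠ π i)) :
    traceThree π ha b i l j = 0 := by
  refine Finset.sum_eq_zero fun k _ => Finset.sum_eq_zero fun y _ => Finset.sum_eq_zero fun x _ => ?_
  by_cases h1 : π i = π j
  · rw [entry_eq_zero π ha b (e := ⟨j, x⟩) (f := ⟨i, k⟩) h1.symm, mul_zero]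
  by_cases h2 : π j = π l
  · rw [entry_eq_zero π ha b (e := ⟨l, y⟩) (f := ⟨j, x⟩) h2.symm, mul_zero, zero_mul]
  by_cases h3 : π l = π i
  · rw [entry_eq_zero π ha b (e := ⟨i, k⟩) (f := ⟨l, y⟩) h3.symm, zero_mul, zero_mul]
  exact absurd ⟨h1, h2, h3⟩ h

/-- The symmetrised quadratic Hamiltonian of a pair of nodes. -/
def pairHamiltonian (i j : I) : WeylAlgebra (omega π a V) :=
  (1 / 2 : ℂ) • (traceTwo π ha b i j + traceTwo π ha b j i)

open Classical in
theorem quantumTrace_quantW2 (i : I) (t : I → ℂ) :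
    quantumTrace π ha b (quantW2 π a i t) =
      ∑ j, pairWeight (WeightSystem.ofReading a ha) π t i j • pairHamiltonian π ha b i j := by
  rw [quantW2, map_sum, ← sum_subtype_of_eq_zero (P := fun j => π i ≠ π j)]
  · refine Finset.sum_congr rfl fun j _ => ?_
    rw [map_smul, quantTwoCycle, map_smul, map_add, quantumTrace_twoCycle, quantumTrace_twoCycle,
      twoCycleWeight_eq (fun e => j.2 (ha e))]
    rfl
  · intro j hj
    rw [pairHamiltonian, traceTwo_of_eq π ha b (not_not.1 hj),
      traceTwo_of_eq π ha b (not_not.1 hj).symm]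
    simp

open Classical in
theorem quantumTrace_quantW3 (i : I) :
    quantumTrace π ha b (quantW3 π a i) =
      cubicPart (WeightSystem.ofReading a ha) π Sigma.fst (entry π ha b) i := by
  have h1 : quantumTrace π ha b (quantW3 π a i) =
      ∑ l, ∑ j, gap (a (π j)) (a (π l)) • traceThree π ha b i l j := by
    rw [quantW3, map_sum, Finset.sum_comm, ← Fintype.sum_prod_type',
      ← sum_subtype_of_eq_zero (P := fun p : I × I => π i ≠ π p.1 ∧ π p.1 ≠ π p.2 ∧ π p.2 ≠ π i)]
    · refine Finset.sum_congr rfl fun p _ => ?_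
      rw [map_smul, quantThreeCycle, quantumTrace_threeCycle]
    · intro p hp
      rw [traceThree_of_eq π ha b hp, smul_zero]
  rw [h1, cubicPart, weightedTrace_fst]
  simp only [cubicMatrix, Fintype.sum_sigma, traceThree, Finset.smul_sum]
  rw [Finset.sum_congr rfl fun l _ => Finset.sum_comm, Finset.sum_comm]
  refine Finset.sum_congr rfl fun k _ => Finset.sum_congr rfl fun l _ => ?_
  rw [Finset.sum_comm]
  rfl

open Classical in
/-- The trace of the quantisation of the quartic potential of a pair of nodes in the same part. -/
def quarticHamiltonian (i m : I) : WeylAlgebra (omega π a V) :=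
  ∑ j, ∑ l, (gap (a (π i)) (a (π j)) * gap (a (π i)) (a (π l))) •
    if j = l then traceFour π ha b j m j i else traceFour π ha b i j m l

open Classical in
theorem quantumTrace_quantW4 (i : I) (t : I → ℂ) :
    quantumTrace π ha b (quantW4 π a i t) =
      ∑ m, timeWeight π t i m • quarticHamiltonian π ha b i m := by
  rw [quantW4, map_sum, ← sum_subtype_of_eq_zero (P := fun m => π m = π i ∧ m ≠ i)]
  · refine Finset.sum_congr rfl fun m _ => ?_
    rw [map_sum, quarticHamiltonian, Finset.smul_sum, ← sum_subtype_of_eq_zero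
      (P := fun j => π j ≠ π i)]
    · refine Finset.sum_congr rfl fun j _ => ?_
      rw [map_sum, Finset.smul_sum, ← sum_subtype_of_eq_zero (P := fun j => π j ≠ π i)]
      · refine Finset.sum_congr rfl fun l _ => ?_
        rw [map_smul, quantFourCycle, timeWeight, if_pos m.2, smul_smul, div_eq_inv_mul]
        congr 1
        split_ifs
        · rw [quantumTrace_fourCycle]
        · rw [quantumTrace_fourCycle]
      · intro l hl
        rw [not_not.1 hl, gap_self]
        simp
    · intro j hj
      rw [not_not.1 hj, gap_self]
      simp
  · intro m hm
    rw [timeWeight, if_neg hm, zero_smul]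

-- The correction requires equal basis indices, hence j = l. One formula therefore covers both
-- anchoring conventions.
open Classical in
theorem quarticHamiltonian_summand {i m : I} (him : i ≠ m) (hp : π i = π m) (j l : I) :
    (if j = l then traceFour π ha b j m j i else traceFour π ha b i j m l) =
      ∑ k : N i, ∑ y : N m, ∑ x : N j, ∑ z : N l,
        (entry π ha b ⟨i, k⟩ ⟨j, x⟩ * entry π ha b ⟨j, x⟩ ⟨m, y⟩ * entry π ha b ⟨m, y⟩ ⟨l, z⟩ *
          entry π ha b ⟨l, z⟩ ⟨i, k⟩ +
        if (⟨j, x⟩ : Σ i, N i) = ⟨l, z⟩ then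
          (gap (a (π i)) (a (π j)))⁻¹ • (entry π ha b ⟨j, x⟩ ⟨m, y⟩ * entry π ha b ⟨m, y⟩ ⟨j, x⟩)
        else 0) := by
  by_cases hjl : j = l
  · subst hjl
    rw [if_pos rfl, traceFour, Finset.sum_comm]
    rw [Finset.sum_congr rfl fun y _ => Finset.sum_congr rfl fun x _ => Finset.sum_comm,
      Finset.sum_congr rfl fun y _ => Finset.sum_comm, Finset.sum_comm]
    refine Finset.sum_congr rfl fun k _ => Finset.sum_congr rfl fun y _ =>
      Finset.sum_congr rfl fun x _ => Finset.sum_congr rfl fun z _ => ?_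
    exact (isWeylMatrix_entry π ha b).quartic_anchor (e := ⟨i, k⟩) (f := ⟨m, y⟩)
      (fun e => him (congrArg Sigma.fst e)) hp ⟨j, x⟩ ⟨j, z⟩
  · have hne : ∀ (x : N j) (z : N l), ¬ (⟨j, x⟩ : Σ i, N i) = ⟨l, z⟩ :=
      fun x z e => hjl (congrArg Sigma.fst e)
    simp only [if_neg hjl, if_neg (hne _ _), add_zero, traceFour]
    exact Finset.sum_congr rfl fun k _ => Finset.sum_comm

/-- The scalar by which `quarticHamiltonian` differs from the block Casimir element. -/
def quarticScalar (π : I → J) (a : J → OnePoint ℂ) (N : I → Type*) [∀ i, Fintype (N i)]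
    (i m : I) : ℂ :=
  ∑ _k : N i, ∑ _y : N m, ∑ x : Σ i, N i,
    gap (a (π m)) (a (π x.1)) * (gap (a (π m)) (a (π x.1)))⁻¹

theorem quarticScalar_swap {i m : I} (hp : π i = π m) :
    quarticScalar π a N i m = quarticScalar π a N m i := by
  rw [quarticScalar, quarticScalar, Finset.sum_comm, hp]

open Classical in
theorem quarticHamiltonian_eq {i m : I} (him : i ≠ m) (hp : π i = π m) :
    quarticHamiltonian π ha b i m =
      casimir (WeightSystem.ofReading a ha) π Sigma.fst (entry π ha b) i m +
        quarticScalar π a N i m • 1 := by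
  have h1 : casimir (WeightSystem.ofReading a ha) π Sigma.fst (entry π ha b) i m +
        quarticScalar π a N i m • 1 = ∑ k : N i, ∑ y : N m, ∑ x, ∑ z,
      (gap (a (π i)) (a (π x.1)) * gap (a (π i)) (a (π z.1))) •
      (entry π ha b ⟨i, k⟩ x * entry π ha b x ⟨m, y⟩ * entry π ha b ⟨m, y⟩ z *
          entry π ha b z ⟨i, k⟩ +
        if x = z then
          (gap (a (π i)) (a (π x.1)))⁻¹ • (entry π ha b x ⟨m, y⟩ * entry π ha b ⟨m, y⟩ x)
        else 0) := by
    rw [casimir, sum_nodeIndicator_fst_mul, quarticScalar]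
    simp only [Finset.sum_smul, ← Finset.sum_add_distrib]
    refine Finset.sum_congr rfl fun k _ => Finset.sum_congr rfl fun y _ => ?_
    rw [← Finset.sum_smul]
    exact ((isWeylMatrix_entry π ha b).sum_quartic (e := ⟨i, k⟩) (f := ⟨m, y⟩) hp).symm
  rw [h1, quarticHamiltonian]
  simp only [quarticHamiltonian_summand π ha b him hp, Fintype.sum_sigma, Finset.smul_sum]
  rw [Finset.sum_congr rfl fun j _ => Finset.sum_comm, Finset.sum_comm]
  refine Finset.sum_congr rfl fun k _ => ?_
  rw [Finset.sum_congr rfl fun j _ => Finset.sum_comm, Finset.sum_comm]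
  refine Finset.sum_congr rfl fun y _ => Finset.sum_congr rfl fun j _ => ?_
  rw [Finset.sum_comm]

-- Mixed derivatives need symmetry on the nose, so the scalar must be symmetric as well; it is, as
-- it depends on the nodes only through their dimensions and common part.
open Classical in
theorem quarticHamiltonian_swap {i m : I} (hp : π i = π m) :
    quarticHamiltonian π ha b i m = quarticHamiltonian π ha b m i := by
  by_cases him : i = m
  · rw [him]
  · rw [quarticHamiltonian_eq π ha b him hp, quarticHamiltonian_eq π ha b (Ne.symm him) hp.symm,
      (isWeylMatrix_entry π ha b).casimir_swap hp, quarticScalar_swap π hp]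

theorem pairHamiltonian_swap (i j : I) :
    pairHamiltonian π ha b i j = pairHamiltonian π ha b j i := by
  rw [pairHamiltonian, pairHamiltonian, add_comm]

theorem exists_pairHamiltonian_eq (i j : I) :
    ∃ s : ℂ, pairHamiltonian π ha b i j = traceTwo π ha b i j + s • 1 := by
  classical
  have h : traceTwo π ha b j i = traceTwo π ha b i j +
      (∑ k : N i, ∑ x : N j, -(gap (a (π j)) (a (π i)))⁻¹) • 1 := by
    rw [traceTwo, traceTwo, Finset.sum_comm]
    simp only [Finset.sum_smul, ← Finset.sum_add_distrib]
    refine Finset.sum_congr rfl fun k _ => Finset.sum_congr rfl fun x _ => ?_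
    rw [mul_eq_mul_add_bracket, (isWeylMatrix_entry π ha b).lie, if_pos rfl, if_pos rfl]
    rfl
  refine ⟨(1 / 2) * ∑ k : N i, ∑ x : N j, -(gap (a (π j)) (a (π i)))⁻¹, ?_⟩
  rw [pairHamiltonian, h]
  module

open Classical in
theorem quadraticPart_entry (i : I) (t : I → ℂ) :
    quadraticPart (WeightSystem.ofReading a ha) π Sigma.fst (entry π ha b) t i =
      ∑ j, pairWeight (WeightSystem.ofReading a ha) π t i j • traceTwo π ha b i j := by
  simp only [quadraticPart, mul_smul, ← Finset.smul_sum, sum_nodeIndicator_fst]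
  simp only [Fintype.sum_sigma, traceTwo, Finset.smul_sum]
  rw [Finset.sum_comm]

open Classical in
theorem quantumHamiltonian_eq (i : I) (t : I → ℂ) :
    quantumHamiltonian π ha b i t =
      ∑ m, timeWeight π t i m • quarticHamiltonian π ha b i m +
      cubicPart (WeightSystem.ofReading a ha) π Sigma.fst (entry π ha b) i +
      ∑ j, pairWeight (WeightSystem.ofReading a ha) π t i j • pairHamiltonian π ha b i j := by
  rw [quantumHamiltonian, quantumIMDPotential, map_add, map_add, quantumTrace_quantW4,
    quantumTrace_quantW3, quantumTrace_quantW2]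

open Classical in
theorem exists_quantumHamiltonian_eq (i : I) (t : I → ℂ) :
    ∃ s : ℂ, quantumHamiltonian π ha b i t =
      hamiltonian (WeightSystem.ofReading a ha) π Sigma.fst (entry π ha b) t i + s • 1 := by
  choose s hs using exists_pairHamiltonian_eq π ha b
  refine ⟨∑ m, timeWeight π t i m * quarticScalar π a N i m +
    ∑ j, pairWeight (WeightSystem.ofReading a ha) π t i j * s i j, ?_⟩
  have h4 : ∀ m, timeWeight π t i m • quarticHamiltonian π ha b i m = timeWeight π t i m •
      casimir (WeightSystem.ofReading a ha) π Sigma.fst (entry π ha b) i m +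
      (timeWeight π t i m * quarticScalar π a N i m) • 1 := by
    intro m
    by_cases hm : π m = π i ∧ m ≠ i
    · rw [quarticHamiltonian_eq π ha b (Ne.symm hm.2) hm.1.symm, smul_add, smul_smul]
    · simp [timeWeight, hm]
  rw [quantumHamiltonian_eq, hamiltonian, quarticPart, quadraticPart_entry]
  simp only [h4, hs, smul_add, smul_smul, Finset.sum_add_distrib, add_smul, Finset.sum_smul]
  abel

theorem quantumHamiltonian_bracket (i j : I) {t : I → ℂ} (ht : t ∈ timeSpace π) :
    ⁅quantumHamiltonian π ha b i t, quantumHamiltonian π ha b j t⁆ = 0 := by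
  classical
  obtain ⟨s, hs⟩ := exists_quantumHamiltonian_eq π ha b i t
  obtain ⟨s', hs'⟩ := exists_quantumHamiltonian_eq π ha b j t
  rw [hs, hs']
  exact add_smul_one_bracket_add_smul_one
    ((isWeylMatrix_entry π ha b).hamiltonian_bracket_hamiltonian ht i j) s s'

end Traces

/-! ### Derivatives of the time-dependent weights. -/

section Derivatives

variable {J I : Type*} {π : I → J}

open Classical in
theorem hasDerivAt_update (t : I → ℂ) (i j : I) :
    HasDerivAt (fun s : ℂ => Function.update t j s i) (if i = j then 1 else 0) (t j) := by
  by_cases h : i = j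
  · subst h
    simpa using hasDerivAt_id' (t i)
  · simpa [h] using hasDerivAt_const (t j) (t i)

open Classical in
/-- The partial derivative of `timeWeight π t i m` with respect to `t j`. -/
def timeWeightDeriv (π : I → J) (t : I → ℂ) (i m j : I) : ℂ :=
  if π m = π i ∧ m ≠ i then
    -((if i = j then 1 else 0) - (if m = j then 1 else 0)) / (t i - t m) ^ 2 else 0

open Classical in
theorem hasDerivAt_timeWeight {t : I → ℂ} (ht : t ∈ timeSpace π) (i m j : I) :
    HasDerivAt (fun s : ℂ => timeWeight π (Function.update t j s) i m)
      (timeWeightDeriv π t i m j) (t j) := by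
  by_cases h : π m = π i ∧ m ≠ i
  · simp only [timeWeight, timeWeightDeriv, if_pos h]
    have h1 := ((hasDerivAt_update t i j).sub (hasDerivAt_update t m j)).inv
      (by simpa using sub_ne_zero.2 (ht i m (Ne.symm h.2) h.1.symm))
    rw [Pi.sub_apply, Function.update_eq_self] at h1
    exact h1
  · simp only [timeWeight, timeWeightDeriv, if_neg h]
    exact hasDerivAt_const _ _

open Classical in
theorem hasDerivAt_pairWeight (ω : WeightSystem J) (t : I → ℂ) (i l j : I) :
    HasDerivAt (fun s : ℂ => pairWeight ω π (Function.update t j s) i l)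
      (ω.slope (π i) (π l) * (if i = j then 1 else 0) - if l = j then 1 else 0) (t j) :=
  ((hasDerivAt_update t i j).const_mul _).sub (hasDerivAt_update t l j)

open Classical in
theorem hasPartialDeriv_of_eq_sum {A : Type*} [Fintype I] [AddCommGroup A] [Module ℂ A]
    {F : (I → ℂ) → A} {j : I} {t : I → ℂ} {c d : (I → ℂ) → I → ℂ} {c' d' : I → ℂ} {x y : I → A}
    {z : A} (hF : ∀ t, F t = ∑ m, c t m • x m + z + ∑ m, d t m • y m)
    (hc : ∀ m, HasDerivAt (fun s => c (Function.update t j s) m) (c' m) (t j))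
    (hd : ∀ m, HasDerivAt (fun s => d (Function.update t j s) m) (d' m) (t j)) :
    HasPartialDeriv F j (∑ m, c' m • x m + ∑ m, d' m • y m) t := by
  intro f
  simp only [hF, map_add, map_sum, map_smul, smul_eq_mul]
  have h1 := HasDerivAt.fun_sum (u := Finset.univ) fun m _ => (hc m).mul_const (f (x m))
  have h2 := HasDerivAt.fun_sum (u := Finset.univ) fun m _ => (hd m).mul_const (f (y m))
  exact (h1.add_const _).add h2

end Derivatives

/-! ### Symmetry of the mixed derivatives. -/

section Flatness

variable {J I : Type*} [Fintype J] [Fintype I] (π : I → J) {a : J → OnePoint ℂ}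
  (ha : Function.Injective a)
  {V : I → Type*} [∀ i, AddCommGroup (V i)] [∀ i, Module ℂ (V i)]
  [∀ i, FiniteDimensional ℂ (V i)]
  {N : I → Type*} [∀ i, Fintype (N i)] (b : ∀ i, Module.Basis (N i) ℂ (V i))

open Classical in
/-- The partial derivative of the Hamiltonian at `i` with respect to `t j`. -/
def hamiltonianDeriv (t : I → ℂ) (i j : I) : WeylAlgebra (omega π a V) :=
  ∑ m, timeWeightDeriv π t i m j • quarticHamiltonian π ha b i m +
    ∑ l, ((WeightSystem.ofReading a ha).slope (π i) (π l) * (if i = j then 1 else 0) -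
      if l = j then 1 else 0) • pairHamiltonian π ha b i l

theorem hasPartialDeriv_quantumHamiltonian (i j : I) {t : I → ℂ} (ht : t ∈ timeSpace π) :
    HasPartialDeriv (quantumHamiltonian π ha b i) j (hamiltonianDeriv π ha b t i j) t :=
  hasPartialDeriv_of_eq_sum (quantumHamiltonian_eq π ha b i)
    (fun m => hasDerivAt_timeWeight ht i m j) fun l => hasDerivAt_pairWeight _ t i l j

/-- Apart from t_i, only the weights attached to the pair (i, j) involve t_j, and in the quadratic
one its coefficient is -1 for every reading. -/
theorem hamiltonianDeriv_of_ne (t : I → ℂ) {i j : I} (hij : i ≠ j) :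
    hamiltonianDeriv π ha b t i j =
      timeWeightDeriv π t i j j • quarticHamiltonian π ha b i j - pairHamiltonian π ha b i j := by
  classical
  rw [hamiltonianDeriv, Finset.sum_eq_single j, Finset.sum_eq_single j]
  · rw [if_neg hij, if_pos rfl, mul_zero, zero_sub, sub_eq_add_neg]
    exact congrArg _ (neg_one_smul ℂ (pairHamiltonian π ha b i j))
  · intro l _ hl
    simp [hij, hl]
  · simp
  · intro m _ hm
    simp [timeWeightDeriv, hij, hm]
  · simp

theorem hamiltonianDeriv_swap (t : I → ℂ) (i j : I) :
    hamiltonianDeriv π ha b t i j = hamiltonianDeriv π ha b t j i := by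
  by_cases hij : i = j
  · rw [hij]
  rw [hamiltonianDeriv_of_ne π ha b t hij, hamiltonianDeriv_of_ne π ha b t (Ne.symm hij),
    pairHamiltonian_swap]
  by_cases hp : π i = π j
  · rw [quarticHamiltonian_swap π ha b hp]
    simp [timeWeightDeriv, hp, hij, Ne.symm hij, sub_sq_comm (t i)]
  · simp [timeWeightDeriv, hp, Ne.symm hp]

end Flatness

end SLQC

end

theorem mainTheorem1 {J I : Type*} [Fintype J] [Fintype I]
    (π : I → J) (hπ : Function.Surjective π)
    (a : J → OnePoint ℂ) (ha : Function.Injective a)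
    (V : I → Type*) [∀ i, AddCommGroup (V i)] [∀ i, Module ℂ (V i)]
    [∀ i, FiniteDimensional ℂ (V i)]
    {N : I → Type*} [∀ i, Fintype (N i)] (b : ∀ i, Module.Basis (N i) ℂ (V i)) :
    SLQC.IsStronglyFlat (SLQC.timeSpace π) (SLQC.quantumHamiltonian π ha b) := by
  intro i j t ht
  refine ⟨SLQC.quantumHamiltonian_bracket π ha b i j ht, SLQC.hamiltonianDeriv π ha b t i j,
    SLQC.hasPartialDeriv_quantumHamiltonian π ha b i j ht, ?_⟩
  rw [SLQC.hamiltonianDeriv_swap]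
  exact SLQC.hasPartialDeriv_quantumHamiltonian π ha b j i ht
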